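/- \textbf{Setting.} All vector fields are smooth. For a vector space $V$ of vector fields on $\mathbb{R}^n$, let $V(\mathbb{R})$ be the set of smooth time-dependent vector fields $X$ on $\mathbb{R}^n$ with $X_t\in V$ for all $t$. A \emph{quasi-Lie scheme} $S(W,V)$ consists of finite-dimensional vector spaces $W\subseteq V$ of vector fields on $\mathbb{R}^n$ with $[W,W]\subseteq W$ and $[W,V]\subseteq V$. A \emph{generalized flow} of a time-dependent vector field $w$ is a smooth map $(t,x)\mapsto g_t(x)\in\mathbb{R}^n$, defined on an open neighbourhood of $\{0\}\times\mathbb{R}^n$ in $\mathbb{R}\times\mathbb{R}^n$ that meets each line $\mathbb{R}\times\{x\}$ in an interval, such that $g_0=\mathrm{Id}$ and $t\mapsto g_t(x)$ is an integral curve of $w$ for every $x$; let $\mathcal{G}(W)$ be the set of generalized flows of elements of $W(\mathbb{R})$. For such $g$ and a time-dependent vector field $X$, $g_\star X$ is the time-dependent vector field, on the image of $\bar g(t,x)=(t,g_t(x))$, with $\partial_t+g_\star X=\bar g_*(\partial_t+X)$; we write $g_\star X\in V_0(\mathbb{R})$ if for each $t$ the field $(g_\star X)_t$ is the restriction to the image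 of $g_t$ of an element of $V_0$. A \emph{quasi-Lie system} of $S(W,V)$ is an $X\in V(\mathbb{R})$ such that $g_\star X\in V_0(\mathbb{R})$ for some $g\in\mathcal{G}(W)$ and some Lie algebra of vector fields $V_0\subseteq V$. For fixed $g$ and $V_0$ the set of quasi-Lie systems $X$ with $g_\star X\in V_0(\mathbb{R})$ is denoted $S_g(W,V;V_0)$. A \emph{common time-dependent superposition rule} for a family $F$ of time-dependent vector fields on $\mathbb{R}^n$ is a smooth map $\Phi(t,x_{(1)},\dots,x_{(m)},k)\in\mathbb{R}^n$, defined on an open set $D\subseteq\mathbb{R}\times(\mathbb{R}^n)^m\times\mathbb{R}^n$ meeting $\{t=0\}$, with $\partial\Phi/\partial k$ invertible on $D$, such that for every $Y\in F$, all solutions $x_{(1)},\dots,x_{(m)}$ of $Y$ on an open interval $I$ and every $k$ with $(t,x_{(1)}(t),\dots,x_{(m)}(t),k)\in D$ for $t\in I$, the curve $t\mapsto\Phi(t,x_{(1)}(t),\dots,x_{(m)}(t),k)$ is a solution of $Y$ on $I$, and every solution of $Y$ on $I$ that agrees with it at one time agrees with it on $I$. The rule is \emph{complete at} $p\in(\mathbb{R}^n)^m$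 if $k\mapsto\Phi(0,p,k)$ is a bijection from $\{k:(0,p,k)\in D\}$ onto $\mathbb{R}^n$, so that it gives every solution near $t=0$ in terms of $m$ solutions with initial values $p$. The family $F$ is a \emph{Lie family} if for some $m$ there is a nonempty open set $U\subseteq(\mathbb{R}^n)^m$ such that for every $p\in U$ there is a common time-dependent superposition rule for $F$ that is complete at $p$. A \emph{time-independent superposition rule associated with} a Lie algebra $V_0$ of vector fields is a map $\Phi(x_{(1)},\dots,x_{(m)},k)$ on a set $D\subseteq(\mathbb{R}^n)^m\times\mathbb{R}^n$ which, regarded as a map on $\mathbb{R}\times D$, is a common superposition rule for $V_0(\mathbb{R})$. \textbf{Proposition.} Let $S(W,V)$ be a quasi-Lie scheme on $\mathbb{R}^n$, $g\in\mathcal{G}(W)$, and $V_0\subseteq V$ a Lie algebra of vector fields. Then $S_g(W,V;V_0)$ is a Lie family. Moreover, for every time-independent superposition rule $\Phi$ (with domain $D$) associated with $V_0$, the map $$\bar\Phi_g(t,x_{(1)},\dots,x_{(m)},k)=g_t^{-1}\bigl(\Phi(g_t(x_{(1)}),\dots,g_t(x_{(m)}),k)\bigr),$$ on the set of all $(t,x_{(1)},\dots,x_{(m)},k)$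 for which each $g_t(x_{(a)})$ is defined, $(g_t(x_{(1)}),\dots,g_t(x_{(m)}),k)\in D$ and $\Phi(g_t(x_{(1)}),\dots,g_t(x_{(m)}),k)$ lies in the image of $g_t$, is a common time-dependent superposition rule for $S_g(W,V;V_0)$, and it is complete at every $p$ at which $\Phi$ is complete. -/

import Mathlib

open scoped ContDiff

noncomputable section

namespace QuasiLie

/-- The space `ℝⁿ`. -/
abbrev E (n : ℕ) : Type := EuclideanSpace ℝ (Fin n)

/-- A time-dependent vector field `X(t,x)` on `ℝⁿ` is smooth if it is `C^∞` jointly in `(t,x)`. -/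
def IsSmoothTimeDep {n : ℕ} (X : ℝ → E n → E n) : Prop :=
  ContDiff ℝ ∞ (fun q : ℝ × E n => X q.1 q.2)

/-- `V(ℝ)`: the (smooth) time-dependent vector fields `X` with `X_t ∈ V` for every `t`. -/
def timeDep {n : ℕ} (V : Submodule ℝ (E n → E n)) : Set (ℝ → E n → E n) :=
  {X | IsSmoothTimeDep X ∧ ∀ t, X t ∈ V}

/-- A Lie algebra of (smooth) vector fields on `ℝⁿ`. -/
structure IsLieAlgebra {n : ℕ} (V : Submodule ℝ (E n → E n)) : Prop where
  smooth : ∀ v ∈ V, ContDiff ℝ ∞ v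
  lie_mem : ∀ v ∈ V, ∀ w ∈ V, VectorField.lieBracket ℝ v w ∈ V

/-- A quasi-Lie scheme `S(W,V)`: finite-dimensional spaces `W ⊆ V` of vector fields with
`[W,W] ⊆ W` and `[W,V] ⊆ V`. -/
structure IsQuasiLieScheme {n : ℕ} (W V : Submodule ℝ (E n → E n)) : Prop where
  smooth : ∀ v ∈ V, ContDiff ℝ ∞ v
  finiteDimensional : FiniteDimensional ℝ V
  le : W ≤ V
  lie_mem : ∀ w₁ ∈ W, ∀ w₂ ∈ W, VectorField.lieBracket ℝ w₁ w₂ ∈ W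
  lie_normalizes : ∀ w ∈ W, ∀ v ∈ V, VectorField.lieBracket ℝ w v ∈ V

/-! ### Generalized flows -/

/-- A map `(t,x) ↦ g_t(x)` together with the set `dom ⊆ ℝ × ℝⁿ` on which it is regarded as
being defined. -/
structure PartialFlow (n : ℕ) where
  dom : Set (ℝ × E n)
  toFun : ℝ → E n → E n

/-- `g` is a generalized flow of the time-dependent vector field `X`: a smooth map on an open
neighbourhood of `{0} × ℝⁿ` such that, for each `x`, the curve `t ↦ g_t(x)` is defined on an
interval around `0` and is the integral curve of `X` with `g_0(x) = x`. The domain need not be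
maximal. -/
structure PartialFlow.IsFlowOf {n : ℕ} (g : PartialFlow n) (X : ℝ → E n → E n) : Prop where
  isOpen_dom : IsOpen g.dom
  zero_mem : ∀ x, ((0 : ℝ), x) ∈ g.dom
  ordConnected : ∀ x, {t : ℝ | (t, x) ∈ g.dom}.OrdConnected
  smooth : ContDiffOn ℝ ∞ (fun q : ℝ × E n => g.toFun q.1 q.2) g.dom
  map_zero : ∀ x, g.toFun 0 x = x
  integralCurve : ∀ x, IsIntegralCurveOn (fun t => g.toFun t x) X {t : ℝ | (t, x) ∈ g.dom}

/-- `𝒢(W)`: the generalized flows of the time-dependent vector fields in `W(ℝ)`. -/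
def generalizedFlows {n : ℕ} (W : Submodule ℝ (E n → E n)) : Set (PartialFlow n) :=
  {g | ∃ w ∈ timeDep W, g.IsFlowOf w}

/-- The domain of the map `g_t`. -/
def PartialFlow.slice {n : ℕ} (g : PartialFlow n) (t : ℝ) : Set (E n) :=
  {x | (t, x) ∈ g.dom}

/-- The image of the map `g_t`. -/
def PartialFlow.image {n : ℕ} (g : PartialFlow n) (t : ℝ) : Set (E n) :=
  g.toFun t '' g.slice t

/-- The map `g_t⁻¹`, meaningful on the image of `g_t`; for a generalized flow of a smooth
time-dependent vector field `g_t` is injective on its domain. -/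
def PartialFlow.inv {n : ℕ} (g : PartialFlow n) (t : ℝ) (y : E n) : E n :=
  Function.invFunOn (g.toFun t) (g.slice t) y

/-- `g_⋆X`: the time-dependent vector field whose autonomization `∂/∂t + g_⋆X` is the push-forward
of the autonomization `∂/∂t + X` by the local diffeomorphism `(t,x) ↦ (t, g_t(x))`. At a point
`(t,y)` with `y = g_t(x)` it is the derivative of `(t,x) ↦ g_t(x)` applied to `(1, X_t(x))`.
It is meaningful for `y` in the image of `g_t`. -/
def PartialFlow.push {n : ℕ} (g : PartialFlow n) (X : ℝ → E n → E n) (t : ℝ) (y : E n) : E n :=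
  fderiv ℝ (fun q : ℝ × E n => g.toFun q.1 q.2) (t, g.inv t y) (1, X t (g.inv t y))

/-- `g_⋆X ∈ V₀(ℝ)`: for each `t` the vector field `(g_⋆X)_t` is, where it is defined,
given by an element of `V₀`. -/
def PartialFlow.PushMem {n : ℕ} (g : PartialFlow n) (X : ℝ → E n → E n)
    (V₀ : Submodule ℝ (E n → E n)) : Prop :=
  ∀ t, ∃ v ∈ V₀, ∀ y ∈ g.image t, g.push X t y = v y

/-- `X` is a quasi-Lie system with respect to the scheme `S(W,V)`. -/
def IsQuasiLieSystem {n : ℕ} (W V : Submodule ℝ (E n → E n)) (X : ℝ → E n → E n) : Prop :=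
  X ∈ timeDep V ∧ ∃ g ∈ generalizedFlows W, ∃ V₀ : Submodule ℝ (E n → E n),
    IsLieAlgebra V₀ ∧ V₀ ≤ V ∧ g.PushMem X V₀

/-- `S_g(W,V;V₀)`: the quasi-Lie systems `X` of the scheme `S(W,V)` with `g_⋆X ∈ V₀(ℝ)`. -/
def quasiLieFamily {n : ℕ} (W V : Submodule ℝ (E n → E n)) (g : PartialFlow n)
    (V₀ : Submodule ℝ (E n → E n)) : Set (ℝ → E n → E n) :=
  {X | IsQuasiLieSystem W V X ∧ g.PushMem X V₀}

/-! ### Superposition rules -/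

/-- `Φ`, with open domain `D`, is a common time-dependent superposition rule for the family `F`:
`Φ(t, x₁, …, x_m; k)` is smooth and regular (a local diffeomorphism) in `k ∈ ℝⁿ`, and for each
system `Y ∈ F`, all particular solutions `x₁(t), …, x_m(t)` of `Y` on an interval and every
constant `k`, the curve `Φ(t, x₁(t), …, x_m(t); k)` is, as long as it stays in the domain, a
solution of `Y`, and it is the solution that has the same value at one time. -/
structure IsSuperpositionRule {n m : ℕ} (F : Set (ℝ → E n → E n))
    (Φ : ℝ → (Fin m → E n) → E n → E n) (D : Set (ℝ × (Fin m → E n) × E n)) : Prop where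
  isOpen_dom : IsOpen D
  nonempty : ∃ x k, ((0 : ℝ), x, k) ∈ D
  smooth : ContDiffOn ℝ ∞ (fun q : ℝ × (Fin m → E n) × E n => Φ q.1 q.2.1 q.2.2) D
  regular : ∀ t x k, (t, x, k) ∈ D → (fderiv ℝ (Φ t x) k).IsInvertible
  solution : ∀ Y ∈ F, ∀ I : Set ℝ, IsOpen I → I.OrdConnected →
    ∀ x : Fin m → ℝ → E n, (∀ a, IsIntegralCurveOn (x a) Y I) →
    ∀ k, (∀ t ∈ I, (t, (fun a => x a t), k) ∈ D) →
      IsIntegralCurveOn (fun t => Φ t (fun a => x a t) k) Y I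
  general : ∀ Y ∈ F, ∀ I : Set ℝ, IsOpen I → I.OrdConnected →
    ∀ x : Fin m → ℝ → E n, (∀ a, IsIntegralCurveOn (x a) Y I) →
    ∀ x₀ : ℝ → E n, IsIntegralCurveOn x₀ Y I →
    ∀ k, (∀ t ∈ I, (t, (fun a => x a t), k) ∈ D) →
    ∀ t₀ ∈ I, x₀ t₀ = Φ t₀ (fun a => x a t₀) k →
      ∀ t ∈ I, x₀ t = Φ t (fun a => x a t) k

/-- Relative to `m` particular solutions with initial values `p = (x₁(0), …, x_m(0))`, the rule
gives the whole general solution: every initial value `x₀(0) ∈ ℝⁿ` is `Φ(0, p; k)` for exactly one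
admissible constant `k`. -/
def IsCompleteAt {n m : ℕ} (Φ : ℝ → (Fin m → E n) → E n → E n)
    (D : Set (ℝ × (Fin m → E n) × E n)) (p : Fin m → E n) : Prop :=
  Set.BijOn (Φ 0 p) {k | ((0 : ℝ), p, k) ∈ D} Set.univ

/-- `F` is a Lie family: for some `m` there is a nonempty open set `U` of generic initial values
of `m`-tuples of particular solutions, at each of which a common time-dependent superposition rule
(defined locally, on an open set) gives the general solution of every system of `F`. -/
def IsLieFamily {n : ℕ} (F : Set (ℝ → E n → E n)) : Prop :=
  ∃ (m : ℕ) (U : Set (Fin m → E n)), IsOpen U ∧ U.Nonempty ∧ ∀ p ∈ U,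
    ∃ (Φ : ℝ → (Fin m → E n) → E n → E n) (D : Set (ℝ × (Fin m → E n) × E n)),
      IsSuperpositionRule F Φ D ∧ IsCompleteAt Φ D p

/-- A time-independent map `Φ(x₁, …, x_m; k)` with domain `D`, regarded as a time-dependent one. -/
def constRule {n m : ℕ} (Φ : (Fin m → E n) → E n → E n) : ℝ → (Fin m → E n) → E n → E n :=
  fun _ => Φ

/-- The domain of `constRule Φ`. -/
def constDom {n m : ℕ} (D : Set ((Fin m → E n) × E n)) : Set (ℝ × (Fin m → E n) × E n) :=
  {q | q.2 ∈ D}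

/-- `Φ`, with domain `D`, is a time-independent superposition rule associated with the Lie algebra
`V₀`: a superposition rule for all Lie systems in `V₀(ℝ)`. -/
def IsLieSuperpositionRule {n m : ℕ} (V₀ : Submodule ℝ (E n → E n))
    (Φ : (Fin m → E n) → E n → E n) (D : Set ((Fin m → E n) × E n)) : Prop :=
  IsSuperpositionRule (timeDep V₀) (constRule Φ) (constDom D)

/-- `Φ̄_g(t, x₁, …, x_m, k) = g_t⁻¹(Φ(g_t(x₁), …, g_t(x_m), k))`. -/
def PartialFlow.conjRule {n m : ℕ} (g : PartialFlow n) (Φ : (Fin m → E n) → E n → E n) :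
    ℝ → (Fin m → E n) → E n → E n :=
  fun t x k => g.inv t (Φ (fun a => g.toFun t (x a)) k)

/-- The set of all `(t, x₁, …, x_m, k)` at which the formula for `Φ̄_g` makes sense. -/
def PartialFlow.conjDom {n m : ℕ} (g : PartialFlow n) (Φ : (Fin m → E n) → E n → E n)
    (D : Set ((Fin m → E n) × E n)) : Set (ℝ × (Fin m → E n) × E n) :=
  {q | (∀ a, q.2.1 a ∈ g.slice q.1) ∧
    ((fun a => g.toFun q.1 (q.2.1 a)), q.2.2) ∈ D ∧
    Φ (fun a => g.toFun q.1 (q.2.1 a)) q.2.2 ∈ g.image q.1}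

end QuasiLie

end

namespace QuasiLie

open Set Filter Topology
open scoped NNReal

/-! ### Uniqueness for ordinary differential equations on intervals -/

section Uniqueness

variable {F : Type*} [NormedAddCommGroup F] [NormedSpace ℝ F]

/-! The maps `g_t` are injective local diffeomorphisms carrying solutions of `X` to solutions of
`g_⋆X`, and their inverses carry them back. A rule for `V₀` therefore becomes, after conjugation by
`g_t`, a rule for every `X` with `g_⋆X ∈ V₀(ℝ)`; since `g_0 = Id`, nothing changes at `t = 0` and
completeness is kept.

One difficulty is that `g_⋆X` lives only on the image of `g`, and that for each `t` the element of
`V₀` extending it need be neither unique nor smooth in `t`, whereas a rule for `V₀` speaks of global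
smooth fields in `V₀(ℝ)`. Being a solution is a local matter, so near a time `t₀` it is enough to
have a field in `V₀(ℝ)` that agrees with `g_⋆X` near the finitely many points concerned. Finite
dimension of `V₀` gives one (`exists_smooth_selection`), and `isIntegralCurveOn_conjRule` concludes.

For the Lie family property a rule for `V₀` must also exist, which is Lie's theorem. Take enough
points `p₁, …, p_m` for the diagonal prolongations of a basis of `V₀` to be independent, and a
complement `S` of their span. Then `(v, s) ↦ (exp(v)(pₐ + sₐ))ₐ` is a local diffeomorphism; solving
it for `v = v(x)` gives the rule `Φ(x, k) = exp(v(x))(k)`, with `Φ(p, k) = k`. It works because the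
derivative of `exp(v)(x)` in the direction `w` is the value at `exp(v)(x)` of a field `ψ(w)` in the
algebra independent of `x` (`exists_fderiv_param`): along solutions, `s` stays constant and `v`
moves so as to reproduce the given field at every point. The smooth exponential comes from the
inverse function theorem applied to the integral equation on a space of continuous curves. -/

theorem eqOn_of_lipschitz {v : ℝ → F → F} {J : Set ℝ} (hJ : J.OrdConnected) {f g : ℝ → F}
    (hf : IsIntegralCurveOn f v J) (hg : IsIntegralCurveOn g v J)
    (hv : ∀ a ∈ J, ∀ b ∈ J, ∃ (K : ℝ≥0) (s : Set F),
      ∀ t ∈ Icc a b, LipschitzOnWith K (v t) s ∧ f t ∈ s ∧ g t ∈ s)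
    {t₀ : ℝ} (ht₀ : t₀ ∈ J) (h : f t₀ = g t₀) : EqOn f g J := by
  intro t ht
  have hsub : ∀ a ∈ J, ∀ b ∈ J, Icc a b ⊆ J := fun a ha b hb => hJ.out ha hb
  have right : ∀ {f : ℝ → F}, IsIntegralCurveOn f v J → ∀ a ∈ J, ∀ b ∈ J, ∀ t ∈ Ico a b,
      HasDerivWithinAt f (v t (f t)) (Ici t) t := by
    intro f hf a ha b hb t ht
    have h1 := (hf t (hsub a ha b hb ⟨ht.1, ht.2.le⟩)).mono
      (hsub t (hsub a ha b hb ⟨ht.1, ht.2.le⟩) b hb)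
    exact h1.mono_of_mem_nhdsWithin (Icc_mem_nhdsGE ht.2)
  have left : ∀ {f : ℝ → F}, IsIntegralCurveOn f v J → ∀ a ∈ J, ∀ b ∈ J, ∀ t ∈ Ioc a b,
      HasDerivWithinAt f (v t (f t)) (Iic t) t := by
    intro f hf a ha b hb t ht
    have h1 := (hf t (hsub a ha b hb ⟨ht.1.le, ht.2⟩)).mono
      (hsub a ha t (hsub a ha b hb ⟨ht.1.le, ht.2⟩))
    exact h1.mono_of_mem_nhdsWithin (Icc_mem_nhdsLE ht.1)
  rcases le_total t₀ t with hle | hle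
  · obtain ⟨K, s, hs⟩ := hv t₀ ht₀ t ht
    exact ODE_solution_unique_of_mem_Icc_right (s := fun _ => s)
      (fun t' ht' => (hs t' (Ico_subset_Icc_self ht')).1)
      (hf.continuousOn.mono (hsub _ ht₀ _ ht)) (right hf _ ht₀ _ ht)
      (fun t' ht' => (hs t' (Ico_subset_Icc_self ht')).2.1)
      (hg.continuousOn.mono (hsub _ ht₀ _ ht)) (right hg _ ht₀ _ ht)
      (fun t' ht' => (hs t' (Ico_subset_Icc_self ht')).2.2) h ⟨hle, le_rfl⟩
  · obtain ⟨K, s, hs⟩ := hv t ht t₀ ht₀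
    exact ODE_solution_unique_of_mem_Icc_left (s := fun _ => s)
      (fun t' ht' => (hs t' (Ioc_subset_Icc_self ht')).1)
      (hf.continuousOn.mono (hsub _ ht _ ht₀)) (left hf _ ht _ ht₀)
      (fun t' ht' => (hs t' (Ioc_subset_Icc_self ht')).2.1)
      (hg.continuousOn.mono (hsub _ ht _ ht₀)) (left hg _ ht _ ht₀)
      (fun t' ht' => (hs t' (Ioc_subset_Icc_self ht')).2.2) h ⟨le_rfl, hle⟩

/-- On a compact interval the norm of `A t` is bounded and serves as a Lipschitz constant. This is
the uniqueness used for variational equations. -/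
theorem eqOn_of_linear {A : ℝ → F →L[ℝ] F} {B : ℝ → F} {J : Set ℝ} (hJ : J.OrdConnected)
    (hA : ContinuousOn A J) {f g : ℝ → F}
    (hf : IsIntegralCurveOn f (fun t x => A t x + B t) J)
    (hg : IsIntegralCurveOn g (fun t x => A t x + B t) J)
    {t₀ : ℝ} (ht₀ : t₀ ∈ J) (h : f t₀ = g t₀) : EqOn f g J := by
  refine eqOn_of_lipschitz hJ hf hg (fun a ha b hb => ?_) ht₀ h
  obtain ⟨C, hC⟩ := (isCompact_Icc (a := a) (b := b)).exists_bound_of_continuousOn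
    (hA.mono (hJ.out ha hb))
  refine ⟨C.toNNReal, univ, fun t ht => ⟨?_, mem_univ _, mem_univ _⟩⟩
  refine LipschitzOnWith.of_dist_le_mul fun x _ y _ => ?_
  rw [dist_add_right, dist_eq_norm, dist_eq_norm, ← map_sub]
  exact ((A t).le_opNorm _).trans
    (mul_le_mul_of_nonneg_right ((hC t ht).trans (Real.le_coe_toNNReal C)) (norm_nonneg _))

/-- Over a compact time interval both curves stay in one closed ball, on which the space derivative
of `X` is bounded by compactness and the mean value inequality applies. -/
theorem eqOn_of_isSmoothTimeDep {n : ℕ} {X : ℝ → E n → E n} (hX : IsSmoothTimeDep X)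
    {J : Set ℝ} (hJ : J.OrdConnected) {f g : ℝ → E n}
    (hf : IsIntegralCurveOn f X J) (hg : IsIntegralCurveOn g X J)
    {t₀ : ℝ} (ht₀ : t₀ ∈ J) (h : f t₀ = g t₀) : EqOn f g J := by
  refine eqOn_of_lipschitz hJ hf hg (fun a ha b hb => ?_) ht₀ h
  have hsub := hJ.out ha hb
  obtain ⟨C₁, hC₁⟩ := (isCompact_Icc (a := a) (b := b)).exists_bound_of_continuousOn
    (hf.continuousOn.mono hsub)
  obtain ⟨C₂, hC₂⟩ := (isCompact_Icc (a := a) (b := b)).exists_bound_of_continuousOn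
    (hg.continuousOn.mono hsub)
  set R := max C₁ C₂
  set D : ℝ × E n → E n →L[ℝ] E n := fun q =>
    (fderiv ℝ (fun q : ℝ × E n => X q.1 q.2) q).comp (ContinuousLinearMap.inr ℝ ℝ (E n))
  have hD : Continuous D := (hX.continuous_fderiv (by simp)).clm_comp continuous_const
  have hXD : ∀ t x, HasFDerivAt (X t) (D (t, x)) x := fun t x =>
    ((hX.differentiable (by simp)) (t, x)).hasFDerivAt.comp x (hasFDerivAt_prodMk_right t x)
  obtain ⟨C, hC⟩ := ((isCompact_Icc (a := a) (b := b)).prod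
    (isCompact_closedBall (0 : E n) R)).exists_bound_of_continuousOn hD.continuousOn
  refine ⟨C.toNNReal, Metric.closedBall 0 R, fun t ht => ⟨?_, ?_, ?_⟩⟩
  · refine (convex_closedBall (0 : E n) R).lipschitzOnWith_of_nnnorm_hasFDerivWithin_le
      (f' := fun x => D (t, x)) (fun x _ => (hXD t x).hasFDerivWithinAt) fun x hx => ?_
    rw [← NNReal.coe_le_coe, coe_nnnorm]
    exact (hC (t, x) ⟨ht, hx⟩).trans (Real.le_coe_toNNReal C)
  · exact mem_closedBall_zero_iff.2 ((hC₁ t ht).trans (le_max_left _ _))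
  · exact mem_closedBall_zero_iff.2 ((hC₂ t ht).trans (le_max_right _ _))

end Uniqueness

/-! ### Smooth local inverses -/

theorem exists_smooth_local_inverse {F G : Type*} [NormedAddCommGroup F] [NormedSpace ℝ F]
    [CompleteSpace F] [NormedAddCommGroup G] [NormedSpace ℝ G] {f : F → G} {s : Set F}
    (hs : IsOpen s) (hf : ContDiffOn ℝ ∞ f s) {a : F} (ha : a ∈ s)
    (hinv : (fderiv ℝ f a).IsInvertible) :
    ∃ h : OpenPartialHomeomorph F G, a ∈ h.source ∧ h.source ⊆ s ∧ (∀ x, h x = f x) ∧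
      (∀ x ∈ h.source, (fderiv ℝ f x).IsInvertible) ∧ ContDiffOn ℝ ∞ h.symm h.target := by
  obtain ⟨e, he⟩ := hinv
  have hfa : ∀ x ∈ s, ContDiffAt ℝ ∞ f x := fun x hx => hf.contDiffAt (hs.mem_nhds hx)
  have hd : ∀ x ∈ s, HasFDerivAt f (fderiv ℝ f x) x := fun x hx =>
    ((hfa x hx).differentiableAt (by simp)).hasFDerivAt
  -- Invertible operators form an open set, so the source can be shrunk until the derivative is
  -- invertible throughout; the inverse is then smooth on the whole target.
  have hopen : IsOpen (s ∩ fderiv ℝ f ⁻¹' (range ((↑) : (F ≃L[ℝ] G) → F →L[ℝ] G))) :=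
    (hf.continuousOn_fderiv_of_isOpen hs (by simp)).isOpen_inter_preimage hs
      ContinuousLinearEquiv.isOpen
  let h₀ := (hfa a ha).toOpenPartialHomeomorph f (he ▸ hd a ha) (by simp)
  refine ⟨h₀.restrOpen _ hopen, ⟨?_, ha, e, he⟩, fun x hx => hx.2.1, fun x => rfl,
    fun x hx => hx.2.2, fun y hy => ContDiffAt.contDiffWithinAt ?_⟩
  · exact ContDiffAt.mem_toOpenPartialHomeomorph_source _ _ _
  · have hy' := (h₀.restrOpen _ hopen).map_target hy
    obtain ⟨e', he'⟩ := hy'.2.2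
    refine OpenPartialHomeomorph.contDiffAt_symm (f₀' := e') _ hy ?_ (hfa _ hy'.2.1)
    rw [he']
    exact hd _ hy'.2.1

/-! ### Smooth time-dependent selections in a finite-dimensional space of vector fields -/

/-- A function killed by all evaluations is zero. Hence a curve in `Q` is smooth in coordinates as
soon as its value at each point is. -/
theorem span_eval_eq_top {N : Type*} (Q : Submodule ℝ (N → ℝ)) [FiniteDimensional ℝ Q] :
    Submodule.span ℝ (range fun y : N => (LinearMap.proj y : (N → ℝ) →ₗ[ℝ] ℝ) ∘ₗ Q.subtype) = ⊤ := by
  refine Submodule.span_eq_top_of_ne_zero fun z hz => ?_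
  by_contra! hcon
  exact hz (Subtype.ext (funext fun y => hcon _ ⟨y, rfl⟩))

/-- The components of a vector field at the points of `N`. -/
def components {n : ℕ} (N : Set (E n)) : (E n → E n) →ₗ[ℝ] (N × Fin n → ℝ) where
  toFun v p := v p.1 p.2
  map_add' _ _ := rfl
  map_smul' _ _ := rfl

theorem components_eq_iff {n : ℕ} {N : Set (E n)} {v w : E n → E n} :
    components N v = components N w ↔ ∀ y ∈ N, v y = w y := by
  refine ⟨fun h y hy => ?_, fun h => ?_⟩
  · ext i
    exact congrFun h (⟨y, hy⟩, i)
  · ext ⟨y, i⟩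
    exact congrArg (fun z : E n => z i) (h y y.2)

/-- Distinct elements of `V₀` may agree on `N`, so the choice of `v` is ambiguous; its restriction
to `N` is not. The restrictions form a finite-dimensional space, where the coordinates of `Z t` are
smooth; a basis is lifted to `V₀` and the coefficients are cut off in time. -/
theorem exists_smooth_selection {n : ℕ} {V₀ : Submodule ℝ (E n → E n)} [FiniteDimensional ℝ V₀]
    (hV₀ : ∀ v ∈ V₀, ContDiff ℝ ∞ v) {N : Set (E n)} {J : Set ℝ} (hJ : IsOpen J)
    {Z : ℝ → E n → E n} (hZ : ∀ t ∈ J, ∃ v ∈ V₀, ∀ y ∈ N, Z t y = v y)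
    (hs : ∀ y ∈ N, ContDiffOn ℝ ∞ (fun t => Z t y) J) {t₀ : ℝ} (ht₀ : t₀ ∈ J) :
    ∃ Y ∈ timeDep V₀, ∀ᶠ t in 𝓝 t₀, ∀ y ∈ N, Y t y = Z t y := by
  classical
  set Q := V₀.map (components N)
  have hmem : ∀ t ∈ J, components N (Z t) ∈ Q := fun t ht => by
    obtain ⟨v, hv, h⟩ := hZ t ht
    exact ⟨v, hv, (components_eq_iff.2 h).symm⟩
  let q : ℝ → Q := fun t => if h : t ∈ J then ⟨_, hmem t h⟩ else 0
  have hq : ∀ t ∈ J, (q t : N × Fin n → ℝ) = components N (Z t) := fun t ht => by simp [q, ht]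
  have hsmooth : ∀ l : Module.Dual ℝ Q, ContDiffOn ℝ ∞ (fun t => l (q t)) J := by
    intro l
    have hl : l ∈ Submodule.span ℝ (range fun y : N × Fin n =>
      (LinearMap.proj y : (N × Fin n → ℝ) →ₗ[ℝ] ℝ) ∘ₗ Q.subtype) := by
      rw [span_eval_eq_top]; trivial
    induction hl using Submodule.span_induction with
    | mem l hl =>
      obtain ⟨⟨y, i⟩, rfl⟩ := hl
      have h1 : ContDiffOn ℝ ∞ (fun t => Z t y i) J :=
        (EuclideanSpace.proj (𝕜 := ℝ) i).contDiff.comp_contDiffOn (hs y y.2)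
      exact h1.congr fun t ht => congrFun (hq t ht) (y, i)
    | zero => exact contDiffOn_const
    | add l₁ l₂ _ _ h₁ h₂ => exact h₁.add h₂
    | smul c l _ h => exact contDiffOn_const.smul h
  let b := Module.finBasis ℝ Q
  choose v hv hvb using fun i => (b i).2
  obtain ⟨ε, hε, hball⟩ := Metric.nhds_basis_closedBall.mem_iff.1 (hJ.mem_nhds ht₀)
  -- The support of `χ` lies in `J`, so the coefficients extend smoothly by zero to all times; near
  -- `t₀`, where `χ = 1`, they are unchanged.
  let χ : ContDiffBump t₀ := ⟨ε / 2, ε, half_pos hε, half_lt_self hε⟩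
  have hc : ∀ i, ContDiff ℝ ∞ fun t => χ t * b.coord i (q t) := by
    intro i
    rw [contDiff_iff_contDiffAt]
    intro t
    by_cases ht : t ∈ J
    · exact χ.contDiffAt.mul ((hsmooth _).contDiffAt (hJ.mem_nhds ht))
    · have h0 : (χ : ℝ → ℝ) =ᶠ[𝓝 t] 0 :=
        notMem_tsupport_iff_eventuallyEq.1 fun h => ht (hball (χ.tsupport_eq ▸ h))
      refine (contDiffAt_const (c := (0 : ℝ))).congr_of_eventuallyEq ?_
      filter_upwards [h0] with s h
      simp [h]
  refine ⟨fun t => ∑ i, (χ t * b.coord i (q t)) • v i, ⟨?_, fun t => ?_⟩, ?_⟩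
  · have : (fun p : ℝ × E n => (∑ i, (χ p.1 * b.coord i (q p.1)) • v i) p.2) =
        fun p => ∑ i, (χ p.1 * b.coord i (q p.1)) • v i p.2 := by
      ext p; simp [Finset.sum_apply]
    unfold IsSmoothTimeDep
    rw [this]
    exact ContDiff.sum fun i _ => ((hc i).comp contDiff_fst).smul
      ((hV₀ _ (hv i)).comp contDiff_snd)
  · exact Submodule.sum_mem _ fun i _ => Submodule.smul_mem _ _ (hv i)
  · filter_upwards [hJ.mem_nhds ht₀, χ.eventuallyEq_one] with t ht h1
    refine components_eq_iff.1 ?_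
    rw [← hq t ht, map_sum]
    conv_rhs => rw [← b.sum_repr (q t)]
    simp only [map_smul, hvb, h1, Pi.one_apply, one_mul, Submodule.coe_sum, Submodule.coe_smul,
      Module.Basis.coord_apply]

/-- Finitely many points suffice to tell the elements of a finite-dimensional space of vector
fields apart. -/
theorem exists_separating_points {n : ℕ} {P : Type*} [AddCommGroup P] [Module ℝ P]
    [FiniteDimensional ℝ P] (X : P →ₗ[ℝ] E n → E n) (hX : Function.Injective X) :
    ∃ (m : ℕ) (p : Fin m → E n), ∀ v, (∀ a, X v (p a) = 0) → v = 0 := by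
  let l : E n × Fin n → Module.Dual ℝ P := fun y =>
    (EuclideanSpace.proj (𝕜 := ℝ) y.2).toLinearMap ∘ₗ LinearMap.proj y.1 ∘ₗ X
  have hspan : Submodule.span ℝ (range l) = ⊤ := by
    refine Submodule.span_eq_top_of_ne_zero fun z hz => ?_
    by_contra! hcon
    refine hz (hX ?_)
    rw [map_zero]
    ext y i
    exact hcon _ ⟨(y, i), rfl⟩
  -- A basis of the dual is extracted from the evaluations of single coordinates at single points;
  -- the same point may occur several times.
  obtain ⟨f, hf, hf', -⟩ := Submodule.exists_fun_fin_finrank_span_eq ℝ (range l)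
  choose y hy using hf
  refine ⟨_, fun a => (y a).1, fun v hv => ?_⟩
  refine (Module.forall_dual_apply_eq_zero_iff ℝ v).1 fun φ => ?_
  have hφ : φ ∈ Submodule.span ℝ (range f) := by rw [hf', hspan]; trivial
  induction hφ using Submodule.span_induction with
  | mem φ h =>
    obtain ⟨a, rfl⟩ := h
    rw [← hy a]
    exact congrArg (fun z : E n => z (y a).2) (hv a)
  | zero => rfl
  | add φ₁ φ₂ _ _ h₁ h₂ => simp [h₁, h₂]
  | smul c φ _ h => simp [h]

/-! ### Generalized flows are families of local diffeomorphisms -/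

theorem isInvertible_of_injective {F G : Type*} [NormedAddCommGroup F] [NormedSpace ℝ F]
    [FiniteDimensional ℝ F] [NormedAddCommGroup G] [NormedSpace ℝ G] [FiniteDimensional ℝ G]
    (hFG : Module.finrank ℝ F = Module.finrank ℝ G) {L : F →L[ℝ] G}
    (hL : ∀ x, L x = 0 → x = 0) : L.IsInvertible := by
  have hinj : Function.Injective (L : F →ₗ[ℝ] G) :=
    (injective_iff_map_eq_zero (L : F →ₗ[ℝ] G)).2 hL
  exact ⟨(LinearEquiv.ofInjectiveOfFinrankEq (L : F →ₗ[ℝ] G) hinj hFG).toContinuousLinearEquiv,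
    by ext; rfl⟩

theorem hasDerivAt_comp_pair {F G H : Type*} [NormedAddCommGroup F] [NormedSpace ℝ F]
    [NormedAddCommGroup G] [NormedSpace ℝ G] [NormedAddCommGroup H] [NormedSpace ℝ H]
    {f : F × G → H} {f' : F × G →L[ℝ] H} {x : ℝ → F} {y : ℝ → G} {x' : F} {y' : G} {t : ℝ}
    (hf : HasFDerivAt f f' (x t, y t)) (hx : HasDerivAt x x' t) (hy : HasDerivAt y y' t) :
    HasDerivAt (fun s => f (x s, y s)) (f' (x', y')) t :=
  HasFDerivAt.comp_hasDerivAt t (f := fun s => (x s, y s)) hf (hx.prodMk hy)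

/-- Mixed second derivatives of `f` exist and commute. -/
theorem exists_second_fderiv {F G : Type*} [NormedAddCommGroup F] [NormedSpace ℝ F]
    [NormedAddCommGroup G] [NormedSpace ℝ G] {f : F → G} {x : F} (hf : ContDiffAt ℝ ∞ f x) :
    ∃ D : F →L[ℝ] F →L[ℝ] G, HasFDerivAt (fderiv ℝ f) D x ∧ (∀ v w, D v w = D w v) ∧
      ∀ v, HasFDerivAt (fun y => fderiv ℝ f y v) (D v) x := by
  have hD : HasFDerivAt (fderiv ℝ f) (fderiv ℝ (fderiv ℝ f) x) x :=
    ((hf.fderiv_right (m := ∞) le_rfl).differentiableAt (by simp)).hasFDerivAt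
  have hsymm : ∀ v w, fderiv ℝ (fderiv ℝ f) x v w = fderiv ℝ (fderiv ℝ f) x w v :=
    hf.isSymmSndFDerivAt (by
      rw [minSmoothness_of_isRCLikeNormedField]
      exact WithTop.coe_le_coe.2 le_top)
  refine ⟨_, hD, hsymm, fun v => ?_⟩
  refine (hD.clm_apply (hasFDerivAt_const v x)).congr_fderiv ?_
  ext u
  simp [hsymm v u]

namespace PartialFlow

variable {n : ℕ} {g : PartialFlow n} {w : ℝ → E n → E n}

/-- The map `(t, x) ↦ g_t(x)`. -/
def total (g : PartialFlow n) (q : ℝ × E n) : E n := g.toFun q.1 q.2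

namespace IsFlowOf

theorem contDiffAt (hg : g.IsFlowOf w) {q : ℝ × E n} (hq : q ∈ g.dom) :
    ContDiffAt ℝ ∞ g.total q :=
  hg.smooth.contDiffAt (hg.isOpen_dom.mem_nhds hq)

theorem hasFDerivAt (hg : g.IsFlowOf w) {q : ℝ × E n} (hq : q ∈ g.dom) :
    HasFDerivAt g.total (fderiv ℝ g.total q) q :=
  ((hg.contDiffAt hq).differentiableAt (by simp)).hasFDerivAt

theorem isOpen_times (hg : g.IsFlowOf w) (x : E n) : IsOpen {t : ℝ | (t, x) ∈ g.dom} :=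
  hg.isOpen_dom.preimage (Continuous.prodMk_left x)

theorem fderiv_time (hg : g.IsFlowOf w) {q : ℝ × E n} (hq : q ∈ g.dom) :
    fderiv ℝ g.total q (1, 0) = w q.1 (g.total q) := by
  have h1 : HasDerivAt (fun t => g.total (t, q.2)) (w q.1 (g.total q)) q.1 :=
    (hg.integralCurve q.2 q.1 hq).hasDerivAt ((hg.isOpen_times q.2).mem_nhds hq)
  have h2 : HasDerivAt (fun t => g.total (t, q.2)) (fderiv ℝ g.total q (1, 0)) q.1 :=
    hasDerivAt_comp_pair (hg.hasFDerivAt hq) (hasDerivAt_id' q.1) (hasDerivAt_const q.1 q.2)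
  exact h2.unique h1

/-- This is the variational equation: differentiate `∂_t g = w(t, g)` in the direction `ξ` and
exchange the two derivatives. -/
theorem hasDerivAt_fderiv_space (hg : g.IsFlowOf w) (hw : IsSmoothTimeDep w) (ξ : E n) {t : ℝ}
    {x : E n} (hq : (t, x) ∈ g.dom) :
    HasDerivAt (fun s => fderiv ℝ g.total (s, x) (0, ξ))
      (fderiv ℝ (fun q : ℝ × E n => w q.1 q.2) (t, g.total (t, x))
        (0, fderiv ℝ g.total (t, x) (0, ξ))) t := by
  obtain ⟨D, hD, hsymm, hDv⟩ := exists_second_fderiv (hg.contDiffAt hq)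
  have h1 : HasDerivAt (fun s => fderiv ℝ g.total (s, x) (0, ξ)) (D (0, ξ) (1, 0)) t :=
    hasDerivAt_comp_pair (hDv (0, ξ)) (hasDerivAt_id' t) (hasDerivAt_const t x)
  have h3 : HasFDerivAt (fun q : ℝ × E n => w q.1 (g.total q))
      ((fderiv ℝ (fun q : ℝ × E n => w q.1 q.2) (t, g.total (t, x))).comp
        ((ContinuousLinearMap.fst ℝ ℝ (E n)).prod (fderiv ℝ g.total (t, x)))) (t, x) :=
    HasFDerivAt.comp (t, x) (f := fun q : ℝ × E n => (q.1, g.total q))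
      (hw.differentiable (by simp) (t, g.total (t, x))).hasFDerivAt
      (hasFDerivAt_fst.prodMk (hg.hasFDerivAt hq))
  have h4 : (fun q => fderiv ℝ g.total q (1, 0)) =ᶠ[𝓝 (t, x)] fun q => w q.1 (g.total q) := by
    filter_upwards [hg.isOpen_dom.mem_nhds hq] with q hq using hg.fderiv_time hq
  have h5 := DFunLike.congr_fun ((h4.hasFDerivAt_iff.1 (hDv (1, 0))).unique h3) ((0 : ℝ), ξ)
  refine h1.congr_deriv ?_
  rw [hsymm]
  simpa using h5

theorem fderiv_space_zero (hg : g.IsFlowOf w) (x ξ : E n) :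
    fderiv ℝ g.total (0, x) (0, ξ) = ξ := by
  have h1 : HasFDerivAt (fun y => g.total (0, y))
      ((fderiv ℝ g.total (0, x)).comp (ContinuousLinearMap.inr ℝ ℝ (E n))) x :=
    (hg.hasFDerivAt (hg.zero_mem x)).comp x (hasFDerivAt_prodMk_right 0 x)
  have h2 : (fun y => g.total (0, y)) = id := funext fun y => hg.map_zero y
  rw [h2] at h1
  simpa using DFunLike.congr_fun (h1.unique (hasFDerivAt_id x)) ξ

/-- The variation solves a linear equation, so if it vanishes at one time it vanishes at time `0`,
where it equals `ξ`. -/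
theorem fderiv_space_injective (hg : g.IsFlowOf w) (hw : IsSmoothTimeDep w) {q : ℝ × E n}
    (hq : q ∈ g.dom) {ξ : E n} (h : fderiv ℝ g.total q (0, ξ) = 0) : ξ = 0 := by
  obtain ⟨t, x⟩ := q
  set A : ℝ → E n →L[ℝ] E n := fun s =>
    (fderiv ℝ (fun q : ℝ × E n => w q.1 q.2) (s, g.total (s, x))).comp
      (ContinuousLinearMap.inr ℝ ℝ (E n))
  have hA : ContinuousOn A {s | (s, x) ∈ g.dom} := by
    refine ContinuousOn.clm_comp ?_ continuousOn_const
    refine (hw.continuous_fderiv (by simp)).comp_continuousOn (continuousOn_id.prodMk ?_)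
    exact (hg.integralCurve x).continuousOn
  have h0 := eqOn_of_linear (B := fun _ => 0) (hg.ordConnected x) hA
    (f := fun s => fderiv ℝ g.total (s, x) (0, ξ)) (g := fun _ => 0)
    (fun s hs => ((hg.hasDerivAt_fderiv_space hw ξ hs).congr_deriv (by simp [A])).hasDerivWithinAt)
    (fun s _ => (hasDerivWithinAt_const s _ _).congr_deriv (by simp)) hq h (hg.zero_mem x)
  exact (hg.fderiv_space_zero x ξ).symm.trans h0

theorem hasFDerivAt_slice (hg : g.IsFlowOf w) {t : ℝ} {x : E n} (hq : (t, x) ∈ g.dom) :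
    HasFDerivAt (g.toFun t)
      ((fderiv ℝ g.total (t, x)).comp (ContinuousLinearMap.inr ℝ ℝ (E n))) x :=
  (hg.hasFDerivAt hq).comp x (hasFDerivAt_prodMk_right t x)

theorem isInvertible_fderiv (hg : g.IsFlowOf w) (hw : IsSmoothTimeDep w) {t : ℝ} {x : E n}
    (hq : (t, x) ∈ g.dom) : (fderiv ℝ (g.toFun t) x).IsInvertible := by
  refine isInvertible_of_injective rfl fun ξ hξ => ?_
  rw [(hg.hasFDerivAt_slice hq).fderiv] at hξ
  exact hg.fderiv_space_injective hw hq (by simpa using hξ)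

/-- Integral curves that meet at time `t` agree on the common interval, which contains `0`. -/
theorem injOn_slice (hg : g.IsFlowOf w) (hw : IsSmoothTimeDep w) (t : ℝ) :
    InjOn (g.toFun t) (g.slice t) := by
  intro x hx y hy hxy
  have := eqOn_of_isSmoothTimeDep hw ((hg.ordConnected x).inter (hg.ordConnected y))
    ((hg.integralCurve x).mono inter_subset_left) ((hg.integralCurve y).mono inter_subset_right)
    ⟨hx, hy⟩ hxy ⟨hg.zero_mem x, hg.zero_mem y⟩
  simpa [hg.map_zero] using this

theorem inv_toFun (hg : g.IsFlowOf w) (hw : IsSmoothTimeDep w) {t : ℝ} {x : E n}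
    (hq : (t, x) ∈ g.dom) : g.inv t (g.toFun t x) = x :=
  (hg.injOn_slice hw t).leftInvOn_invFunOn hq

end IsFlowOf

theorem inv_mem {t : ℝ} {y : E n} (hy : y ∈ g.image t) : (t, g.inv t y) ∈ g.dom :=
  Function.invFunOn_mem hy

theorem toFun_inv {t : ℝ} {y : E n} (hy : y ∈ g.image t) : g.toFun t (g.inv t y) = y :=
  Function.invFunOn_eq hy

/-- The image of the map `(t, x) ↦ (t, g_t(x))`. -/
def totalImage (g : PartialFlow n) : Set (ℝ × E n) := {q | q.2 ∈ g.image q.1}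

namespace IsFlowOf

/-- The inverse function theorem applies to `(t, x) ↦ (t, g_t(x))`, and injectivity of `g_t`
identifies its local inverse with `g.inv`. -/
theorem exists_localInverse (hg : g.IsFlowOf w) (hw : IsSmoothTimeDep w) {q : ℝ × E n}
    (hq : q ∈ g.totalImage) : ∃ s, IsOpen s ∧ q ∈ s ∧ s ⊆ g.totalImage ∧
      ContDiffOn ℝ ∞ (fun q : ℝ × E n => g.inv q.1 q.2) s := by
  obtain ⟨t, y⟩ := q
  obtain ⟨x, hx, rfl⟩ : y ∈ g.image t := hq
  have hx' : (t, x) ∈ g.dom := hx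
  have hinv : (fderiv ℝ (fun q : ℝ × E n => (q.1, g.total q)) (t, x)).IsInvertible := by
    refine isInvertible_of_injective rfl fun v hv => ?_
    rw [(hasFDerivAt_fst.prodMk (hg.hasFDerivAt hx')).fderiv] at hv
    obtain ⟨τ, ξ⟩ := v
    obtain ⟨h1, h2⟩ : τ = 0 ∧ fderiv ℝ g.total (t, x) (τ, ξ) = 0 := by simpa using hv
    subst h1
    rw [hg.fderiv_space_injective hw hx' h2]
    rfl
  obtain ⟨h, hxh, hsub, heq, -, hsm⟩ := exists_smooth_local_inverse hg.isOpen_dom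
    (contDiffOn_fst.prodMk hg.smooth) hx' hinv
  have key : ∀ p ∈ h.target, ∃ x, (p.1, x) ∈ g.dom ∧ p.2 = g.toFun p.1 x ∧
      x = (h.symm p).2 := by
    intro p hp
    have h1 := (heq _).symm.trans (h.right_inv hp)
    have h2 : (h.symm p).1 = p.1 := (Prod.ext_iff.1 h1).1
    refine ⟨(h.symm p).2, ?_, ?_, rfl⟩
    · rw [← h2]
      exact hsub (h.map_target hp)
    · rw [← h2]
      exact (Prod.ext_iff.1 h1).2.symm
  refine ⟨h.target, h.open_target, ?_, ?_, ?_⟩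
  · have := h.map_source hxh
    rwa [heq] at this
  · intro p hp
    obtain ⟨x, hx, h1, -⟩ := key p hp
    exact ⟨x, hx, h1.symm⟩
  · refine (contDiff_snd.comp_contDiffOn hsm).congr fun p hp => ?_
    obtain ⟨x, hx, h1, h2⟩ := key p hp
    simp only [Function.comp_apply, ← h2, h1]
    exact hg.inv_toFun hw hx

theorem isOpen_totalImage (hg : g.IsFlowOf w) (hw : IsSmoothTimeDep w) : IsOpen g.totalImage := by
  refine isOpen_iff_forall_mem_open.2 fun q hq => ?_
  obtain ⟨s, hs, hqs, hsub, -⟩ := hg.exists_localInverse hw hq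
  exact ⟨s, hsub, hs, hqs⟩

theorem contDiffOn_inv (hg : g.IsFlowOf w) (hw : IsSmoothTimeDep w) :
    ContDiffOn ℝ ∞ (fun q : ℝ × E n => g.inv q.1 q.2) g.totalImage := fun q hq => by
  obtain ⟨s, hs, hqs, -, hsm⟩ := hg.exists_localInverse hw hq
  exact (hsm.contDiffAt (hs.mem_nhds hqs)).contDiffWithinAt

theorem contDiffOn_push (hg : g.IsFlowOf w) (hw : IsSmoothTimeDep w) {X : ℝ → E n → E n}
    (hX : IsSmoothTimeDep X) :
    ContDiffOn ℝ ∞ (fun q : ℝ × E n => g.push X q.1 q.2) g.totalImage := by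
  have hinv : ContDiffOn ℝ ∞ (fun q : ℝ × E n => (q.1, g.inv q.1 q.2)) g.totalImage :=
    contDiffOn_fst.prodMk (hg.contDiffOn_inv hw)
  refine ContDiffOn.clm_apply ?_ (contDiffOn_const.prodMk (hX.comp_contDiffOn hinv))
  exact ((hg.smooth.fderiv_of_isOpen hg.isOpen_dom (m := ∞) (by simp)).comp hinv
    fun q hq => inv_mem hq)

/-- The flow carries the solutions of `X` to those of `g_⋆X`. -/
theorem hasDerivAt_push (hg : g.IsFlowOf w) (hw : IsSmoothTimeDep w) {X : ℝ → E n → E n}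
    {x : ℝ → E n} {t : ℝ} (hx : HasDerivAt x (X t (x t)) t) (hq : (t, x t) ∈ g.dom) :
    HasDerivAt (fun s => g.toFun s (x s)) (g.push X t (g.toFun t (x t))) t := by
  have h1 : HasDerivAt (fun s => g.total (s, x s))
      (fderiv ℝ g.total (t, x t) (1, X t (x t))) t :=
    hasDerivAt_comp_pair (hg.hasFDerivAt hq) (hasDerivAt_id' t) hx
  unfold push
  rw [hg.inv_toFun hw hq]
  exact h1

/-- The inverse of the flow carries the solutions of `g_⋆X` to those of `X`. -/
theorem hasDerivAt_inv (hg : g.IsFlowOf w) (hw : IsSmoothTimeDep w) {X : ℝ → E n → E n}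
    {y : ℝ → E n} {t : ℝ} (hy : HasDerivAt y (g.push X t (y t)) t)
    (hq : (t, y t) ∈ g.totalImage) :
    HasDerivAt (fun s => g.inv s (y s)) (X t (g.inv t (y t))) t := by
  have hopen := hg.isOpen_totalImage hw
  have hdiff : DifferentiableAt ℝ (fun s => g.inv s (y s)) t :=
    DifferentiableAt.comp t (f := fun s => (s, y s)) (g := fun q : ℝ × E n => g.inv q.1 q.2)
      (((hg.contDiffOn_inv hw).contDiffAt (hopen.mem_nhds hq)).differentiableAt (by simp))
      (differentiableAt_id.prodMk hy.differentiableAt)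
  have hz := hdiff.hasDerivAt
  have hdom : (t, g.inv t (y t)) ∈ g.dom := inv_mem hq
  have h1 : HasDerivAt (fun s => g.total (s, g.inv s (y s)))
      (fderiv ℝ g.total (t, g.inv t (y t)) (1, deriv (fun s => g.inv s (y s)) t)) t :=
    hasDerivAt_comp_pair (hg.hasFDerivAt hdom) (hasDerivAt_id' t) hz
  have h2 : (fun s => g.total (s, g.inv s (y s))) =ᶠ[𝓝 t] y := by
    filter_upwards [(continuousAt_id.prodMk hy.continuousAt).preimage_mem_nhds
      (hopen.mem_nhds hq)] with s hs using toFun_inv hs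
  -- Both space-time velocities are sent to the velocity of `y`. Their difference has no time
  -- component, so injectivity of the space derivative makes them equal.
  have h3 : fderiv ℝ g.total (t, g.inv t (y t)) (1, deriv (fun s => g.inv s (y s)) t) =
      fderiv ℝ g.total (t, g.inv t (y t)) (1, X t (g.inv t (y t))) :=
    (h2.hasDerivAt_iff.1 h1).unique hy
  rw [← sub_eq_zero, ← map_sub] at h3
  have h4 := hg.fderiv_space_injective hw hdom
    (ξ := deriv (fun s => g.inv s (y s)) t - X t (g.inv t (y t))) (by simpa using h3)
  rw [sub_eq_zero] at h4
  rwa [h4] at hz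

end IsFlowOf

end PartialFlow

/-! ### Superposition rules transported by a generalized flow -/

/-- A superposition rule gives the solution with the prescribed value at one time as soon as it
gives solutions, by uniqueness. -/
theorem eq_of_solution {n m : ℕ} {F : Set (ℝ → E n → E n)} (hF : ∀ Y ∈ F, IsSmoothTimeDep Y)
    {Φ : ℝ → (Fin m → E n) → E n → E n} {D : Set (ℝ × (Fin m → E n) × E n)}
    (h : ∀ Y ∈ F, ∀ I : Set ℝ, IsOpen I → I.OrdConnected →
      ∀ x : Fin m → ℝ → E n, (∀ a, IsIntegralCurveOn (x a) Y I) →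
      ∀ k, (∀ t ∈ I, (t, (fun a => x a t), k) ∈ D) →
        IsIntegralCurveOn (fun t => Φ t (fun a => x a t) k) Y I) :
    ∀ Y ∈ F, ∀ I : Set ℝ, IsOpen I → I.OrdConnected →
      ∀ x : Fin m → ℝ → E n, (∀ a, IsIntegralCurveOn (x a) Y I) →
      ∀ x₀ : ℝ → E n, IsIntegralCurveOn x₀ Y I →
      ∀ k, (∀ t ∈ I, (t, (fun a => x a t), k) ∈ D) →
      ∀ t₀ ∈ I, x₀ t₀ = Φ t₀ (fun a => x a t₀) k →
        ∀ t ∈ I, x₀ t = Φ t (fun a => x a t) k :=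
  fun Y hY I hI hIc x hx _ hx₀ k hk _ ht₀ h₀ _ ht =>
    eqOn_of_isSmoothTimeDep (hF Y hY) hIc hx₀ (h Y hY I hI hIc x hx k hk) ht₀ h₀ ht

namespace IsLieSuperpositionRule

variable {n m : ℕ} {V₀ : Submodule ℝ (E n → E n)} {Φ : (Fin m → E n) → E n → E n}
  {D : Set ((Fin m → E n) × E n)}

theorem isOpen (h : IsLieSuperpositionRule V₀ Φ D) : IsOpen D :=
  h.isOpen_dom.preimage (Continuous.prodMk_right (0 : ℝ))

theorem contDiffOn (h : IsLieSuperpositionRule V₀ Φ D) :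
    ContDiffOn ℝ ∞ (fun q : (Fin m → E n) × E n => Φ q.1 q.2) D :=
  h.smooth.comp ((contDiff_prodMk_right (0 : ℝ)).contDiffOn) fun _ hq => hq

end IsLieSuperpositionRule

namespace PartialFlow

variable {n m : ℕ} {g : PartialFlow n} {w : ℝ → E n → E n} {V₀ : Submodule ℝ (E n → E n)}
  {Φ : (Fin m → E n) → E n → E n} {D : Set ((Fin m → E n) × E n)}

/-- The map `(t, x₁, …, x_m, k) ↦ (g_t(x₁), …, g_t(x_m), k)`. -/
def spread (g : PartialFlow n) (q : ℝ × (Fin m → E n) × E n) : (Fin m → E n) × E n :=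
  (fun a => g.toFun q.1 (q.2.1 a), q.2.2)

/-- The domain of `PartialFlow.spread`. -/
def spreadDom (g : PartialFlow n) (m : ℕ) : Set (ℝ × (Fin m → E n) × E n) :=
  {q | ∀ a, q.2.1 a ∈ g.slice q.1}

namespace IsFlowOf

theorem isOpen_spreadDom (hg : g.IsFlowOf w) : IsOpen (g.spreadDom m) := by
  simp only [spreadDom, ofPred_forall]
  exact isOpen_iInter_of_finite fun a => hg.isOpen_dom.preimage
    (f := fun q : ℝ × (Fin m → E n) × E n => (q.1, q.2.1 a)) (by fun_prop)

theorem contDiffOn_spread (hg : g.IsFlowOf w) : ContDiffOn ℝ ∞ g.spread (g.spreadDom m) := by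
  refine ContDiffOn.prodMk (contDiffOn_pi.2 fun a => ?_) (contDiff_snd.snd.contDiffOn)
  refine hg.smooth.comp (s := g.spreadDom m)
    (f := fun q : ℝ × (Fin m → E n) × E n => (q.1, q.2.1 a)) (ContDiff.contDiffOn ?_)
    fun q hq => hq a
  fun_prop

theorem contDiffOn_rule_spread (hg : g.IsFlowOf w) (h : IsLieSuperpositionRule V₀ Φ D) :
    ContDiffOn ℝ ∞ (fun q : ℝ × (Fin m → E n) × E n => (q.1, Φ (g.spread q).1 (g.spread q).2))
      (g.spreadDom m ∩ g.spread ⁻¹' D) :=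
  contDiffOn_fst.prodMk
    (h.contDiffOn.comp (hg.contDiffOn_spread.mono inter_subset_left) fun _ hq => hq.2)

theorem conjDom_eq : g.conjDom Φ D = (g.spreadDom m ∩ g.spread ⁻¹' D) ∩
    (fun q : ℝ × (Fin m → E n) × E n => (q.1, Φ (g.spread q).1 (g.spread q).2)) ⁻¹'
      g.totalImage := by
  ext q
  exact and_assoc.symm

theorem isOpen_conjDom (hg : g.IsFlowOf w) (hw : IsSmoothTimeDep w)
    (h : IsLieSuperpositionRule V₀ Φ D) : IsOpen (g.conjDom Φ D) := by
  rw [conjDom_eq]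
  exact (hg.contDiffOn_rule_spread h).continuousOn.isOpen_inter_preimage
    (hg.contDiffOn_spread.continuousOn.isOpen_inter_preimage hg.isOpen_spreadDom h.isOpen)
    (hg.isOpen_totalImage hw)

theorem contDiffOn_conjRule (hg : g.IsFlowOf w) (hw : IsSmoothTimeDep w)
    (h : IsLieSuperpositionRule V₀ Φ D) :
    ContDiffOn ℝ ∞ (fun q : ℝ × (Fin m → E n) × E n => g.conjRule Φ q.1 q.2.1 q.2.2)
      (g.conjDom Φ D) := by
  rw [conjDom_eq]
  exact (hg.contDiffOn_inv hw).comp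
    ((hg.contDiffOn_rule_spread h).mono inter_subset_left) fun _ hq => hq.2

/-- Composing the conjugated rule with `g_t` gives `Φ(g_t(x), ·)`, whose derivative is invertible;
the inner derivative is thus injective between spaces of equal dimension. -/
theorem isInvertible_fderiv_conjRule (hg : g.IsFlowOf w) (hw : IsSmoothTimeDep w)
    (h : IsLieSuperpositionRule V₀ Φ D) {t : ℝ} {x : Fin m → E n} {k : E n}
    (hq : (t, x, k) ∈ g.conjDom Φ D) : (fderiv ℝ (g.conjRule Φ t x) k).IsInvertible := by
  have hopen : IsOpen (g.conjDom Φ D) := hg.isOpen_conjDom hw h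
  have hcont : Continuous fun k : E n => (t, x, k) := by fun_prop
  have hdiff : DifferentiableAt ℝ (g.conjRule Φ t x) k :=
    DifferentiableAt.comp k (f := fun k => (t, x, k))
      (g := fun q : ℝ × (Fin m → E n) × E n => g.conjRule Φ q.1 q.2.1 q.2.2)
      (((hg.contDiffOn_conjRule hw h).contDiffAt (hopen.mem_nhds hq)).differentiableAt (by simp))
      (by fun_prop)
  have hcomp := (hg.hasFDerivAt_slice (inv_mem hq.2.2)).comp k hdiff.hasFDerivAt
  have heq : (g.toFun t ∘ g.conjRule Φ t x) =ᶠ[𝓝 k] Φ fun a => g.toFun t (x a) := by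
    filter_upwards [hcont.continuousAt.preimage_mem_nhds (hopen.mem_nhds hq)] with k' hk'
    exact toFun_inv hk'.2.2
  have hfd := (heq.hasFDerivAt_iff.1 hcomp).fderiv
  obtain ⟨e, he⟩ := h.regular 0 _ k hq.2.1
  change (e : E n →L[ℝ] E n) = fderiv ℝ (Φ fun a => g.toFun t (x a)) k at he
  rw [hfd] at he
  refine isInvertible_of_injective rfl fun ξ hξ => e.injective ?_
  rw [_root_.map_zero]
  exact (DFunLike.congr_fun he ξ).trans (by simp [hξ, ← Prod.zero_eq_mk])

/-- The curves `y a` solve `g_⋆X`. Near `t₀` this field is replaced by some `Y` in `V₀(ℝ)` with the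
same values along the `y a` and along `y₀`; the rule makes `y₀` a solution of `Y`, hence of `g_⋆X`
at `t₀`, and the inverse flow brings it back. -/
theorem isIntegralCurveOn_conjRule [FiniteDimensional ℝ V₀] (hV₀ : ∀ v ∈ V₀, ContDiff ℝ ∞ v)
    (hg : g.IsFlowOf w) (hw : IsSmoothTimeDep w) (h : IsLieSuperpositionRule V₀ Φ D)
    {X : ℝ → E n → E n} (hX : IsSmoothTimeDep X) (hpush : g.PushMem X V₀) {I : Set ℝ}
    (hI : IsOpen I) {x : Fin m → ℝ → E n} (hx : ∀ a, IsIntegralCurveOn (x a) X I) {k : E n}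
    (hk : ∀ t ∈ I, (t, (fun a => x a t), k) ∈ g.conjDom Φ D) :
    IsIntegralCurveOn (fun t => g.conjRule Φ t (fun a => x a t) k) X I := by
  intro t₀ ht₀
  refine HasDerivAt.hasDerivWithinAt ?_
  let y : Fin m → ℝ → E n := fun a t => g.toFun t (x a t)
  let y₀ : ℝ → E n := fun t => Φ (fun a => y a t) k
  have hy : ∀ t ∈ I, ∀ a, HasDerivAt (y a) (g.push X t (y a t)) t := fun t ht a =>
    hg.hasDerivAt_push hw ((hx a t ht).hasDerivAt (hI.mem_nhds ht)) ((hk t ht).1 a)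
  have hy₀ : ContinuousAt y₀ t₀ :=
    ContinuousAt.comp (f := fun t => ((fun a => y a t), k))
      (g := fun q : (Fin m → E n) × E n => Φ q.1 q.2)
      (h.contDiffOn.continuousOn.continuousAt (h.isOpen.mem_nhds (hk t₀ ht₀).2.1))
      ((continuousAt_pi.2 fun a => (hy t₀ ht₀ a).continuousAt).prodMk continuousAt_const)
  -- The curve `y₀` joins the list, since `Y` must match `g_⋆X` along it as well.
  let z : Option (Fin m) → ℝ → E n := fun i => i.elim y₀ y
  have hz : ∀ i, ContinuousAt (z i) t₀ := by
    rintro (_ | a)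
    · exact hy₀
    · exact (hy t₀ ht₀ a).continuousAt
  have hzmem : ∀ i, (t₀, z i t₀) ∈ g.totalImage := by
    rintro (_ | a)
    · exact (hk t₀ ht₀).2.2
    · exact ⟨_, (hk t₀ ht₀).1 a, rfl⟩
  -- Product neighbourhoods inside the open image of the flow give a space set independent of `t`,
  -- as the selection requires.
  choose J N hJ hJt hN hNz hsub using fun i =>
    mem_nhds_prod_iff'.1 ((hg.isOpen_totalImage hw).mem_nhds (hzmem i))
  have hsub' : ∀ t ∈ ⋂ i, J i, ∀ p ∈ ⋃ i, N i, (t, p) ∈ g.totalImage := fun t ht p hp => by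
    obtain ⟨i, hi⟩ := mem_iUnion.1 hp
    exact hsub i ⟨mem_iInter.1 ht i, hi⟩
  have hJo : IsOpen (⋂ i, J i) := isOpen_iInter_of_finite hJ
  obtain ⟨Y, hY, hYeq⟩ := exists_smooth_selection hV₀ (N := ⋃ i, N i) hJo (Z := g.push X)
    (fun t ht => by
      obtain ⟨v, hv, hveq⟩ := hpush t
      exact ⟨v, hv, fun p hp => hveq p (hsub' t ht p hp)⟩)
    (fun p hp => (hg.contDiffOn_push hw hX).comp (contDiffOn_id.prodMk contDiffOn_const)
      fun t ht => hsub' t ht p hp)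
    (mem_iInter.2 hJt)
  have hev : ∀ᶠ t in 𝓝 t₀, t ∈ I ∧ ∀ i, Y t (z i t) = g.push X t (z i t) := by
    have hzN : ∀ᶠ t in 𝓝 t₀, ∀ i, z i t ∈ N i :=
      eventually_all.2 fun i => (hz i).preimage_mem_nhds ((hN i).mem_nhds (hNz i))
    filter_upwards [hYeq, hI.mem_nhds ht₀, hzN] with t h1 h2 h3
    exact ⟨h2, fun i => h1 _ (mem_iUnion.2 ⟨i, h3 i⟩)⟩
  obtain ⟨ε, hε, hball⟩ := Metric.eventually_nhds_iff_ball.1 hev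
  have hsol : IsIntegralCurveOn y₀ Y (Metric.ball t₀ ε) :=
    h.solution Y hY _ Metric.isOpen_ball (convex_ball t₀ ε).ordConnected y
      (fun a t ht => by
        rw [show Y t (y a t) = g.push X t (y a t) from (hball t ht).2 (some a)]
        exact (hy t (hball t ht).1 a).hasDerivWithinAt)
      k fun t ht => (hk t (hball t ht).1).2.1
  have hd := (hsol t₀ (Metric.mem_ball_self hε)).hasDerivAt (Metric.ball_mem_nhds t₀ hε)
  rw [show Y t₀ (y₀ t₀) = g.push X t₀ (y₀ t₀) from
    (hball t₀ (Metric.mem_ball_self hε)).2 none] at hd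
  exact hg.hasDerivAt_inv hw hd (hk t₀ ht₀).2.2

theorem slice_zero (hg : g.IsFlowOf w) : g.slice 0 = univ :=
  eq_univ_of_forall hg.zero_mem

theorem toFun_zero (hg : g.IsFlowOf w) : g.toFun 0 = id := funext hg.map_zero

theorem image_zero (hg : g.IsFlowOf w) : g.image 0 = univ := by
  rw [image, hg.slice_zero, hg.toFun_zero, image_id]

theorem inv_zero (hg : g.IsFlowOf w) (y : E n) : g.inv 0 y = y := by
  have := toFun_inv (g := g) (t := 0) (y := y) (hg.image_zero ▸ mem_univ y)
  rwa [hg.map_zero] at this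

theorem zero_mem_conjDom_iff (hg : g.IsFlowOf w) {x : Fin m → E n} {k : E n} :
    ((0 : ℝ), x, k) ∈ g.conjDom Φ D ↔ (x, k) ∈ D := by
  simp [conjDom, hg.slice_zero, hg.image_zero, hg.map_zero]

theorem conjRule_zero (hg : g.IsFlowOf w) (x : Fin m → E n) : g.conjRule Φ 0 x = Φ x := by
  ext1 k
  simp [conjRule, hg.inv_zero, hg.map_zero]

theorem isSuperpositionRule_conjRule [FiniteDimensional ℝ V₀] (hV₀ : ∀ v ∈ V₀, ContDiff ℝ ∞ v)
    (hg : g.IsFlowOf w) (hw : IsSmoothTimeDep w) (h : IsLieSuperpositionRule V₀ Φ D)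
    {F : Set (ℝ → E n → E n)} (hF : ∀ X ∈ F, IsSmoothTimeDep X)
    (hpush : ∀ X ∈ F, g.PushMem X V₀) :
    IsSuperpositionRule F (g.conjRule Φ) (g.conjDom Φ D) where
  isOpen_dom := hg.isOpen_conjDom hw h
  nonempty := by
    obtain ⟨x, k, hxk⟩ := h.nonempty
    exact ⟨x, k, hg.zero_mem_conjDom_iff.2 hxk⟩
  smooth := hg.contDiffOn_conjRule hw h
  regular _ _ _ hq := hg.isInvertible_fderiv_conjRule hw h hq
  solution X hX _ hI _ _ hx _ hk :=
    hg.isIntegralCurveOn_conjRule hV₀ hw h (hF X hX) (hpush X hX) hI hx hk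
  general := eq_of_solution hF fun X hX _ hI _ _ hx _ hk =>
    hg.isIntegralCurveOn_conjRule hV₀ hw h (hF X hX) (hpush X hX) hI hx hk

theorem isCompleteAt_conjRule (hg : g.IsFlowOf w) {p : Fin m → E n}
    (h : IsCompleteAt (constRule Φ) (constDom D) p) :
    IsCompleteAt (g.conjRule Φ) (g.conjDom Φ D) p := by
  unfold IsCompleteAt at h ⊢
  simp only [hg.conjRule_zero, hg.zero_mem_conjDom_iff]
  exact h

end IsFlowOf

end PartialFlow

/-! ### Superposition operators on spaces of continuous maps -/

section Superposition

universe u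

variable {K : Type*} [TopologicalSpace K] [CompactSpace K] {F G : Type u}
  [NormedAddCommGroup F] [NormedSpace ℝ F] [NormedAddCommGroup G] [NormedSpace ℝ G]

/-- Pointwise application of a continuous family of continuous linear maps. -/
noncomputable def pointwiseApply : C(K, F →L[ℝ] G) →L[ℝ] C(K, F) →L[ℝ] C(K, G) :=
  LinearMap.mkContinuous₂
    (LinearMap.mk₂ ℝ (fun (φ : C(K, F →L[ℝ] G)) (h : C(K, F)) =>
        (⟨fun t => φ t (h t), φ.continuous.clm_apply h.continuous⟩ : C(K, G)))
      (fun _ _ _ => by ext; simp) (fun _ _ _ => by ext; simp)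
      (fun _ _ _ => by ext; simp) (fun _ _ _ => by ext; simp)) 1 fun φ h => by
    rw [ContinuousMap.norm_le _ (by positivity), one_mul]
    exact fun t => ((φ t).le_opNorm _).trans
      (mul_le_mul (φ.norm_coe_le_norm t) (h.norm_coe_le_norm t) (norm_nonneg _) (norm_nonneg φ))

/-- By compactness of `K`, the derivative of `f` varies by less than `ε` on balls of one radius
around all the `γ t`; the mean value inequality then bounds the remainder uniformly. -/
theorem hasFDerivAt_comp {f : F → G} (hf : ContDiff ℝ ∞ f) (γ : C(K, F)) :
    HasFDerivAt (fun γ : C(K, F) => ContinuousMap.comp ⟨f, hf.continuous⟩ γ)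
      (pointwiseApply (ContinuousMap.comp ⟨fderiv ℝ f, hf.continuous_fderiv (by simp)⟩ γ)) γ := by
  have hf' : Continuous (fderiv ℝ f) := hf.continuous_fderiv (by simp)
  rw [hasFDerivAt_iff_isLittleO_nhds_zero, Asymptotics.isLittleO_iff]
  intro ε hε
  have hev : ∀ᶠ u : F in 𝓝 0, ∀ t ∈ (univ : Set K),
      ‖fderiv ℝ f (γ t + u) - fderiv ℝ f (γ t)‖ < ε := by
    refine isCompact_univ.eventually_forall_of_forall_eventually fun t _ => ?_
    have hc : Continuous fun z : F × K => ‖fderiv ℝ f (γ z.2 + z.1) - fderiv ℝ f (γ z.2)‖ := by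
      fun_prop
    exact hc.continuousAt.eventually_lt continuousAt_const (by simpa using hε)
  obtain ⟨δ, hδ, hball⟩ := Metric.eventually_nhds_iff_ball.1 hev
  filter_upwards [Metric.ball_mem_nhds (0 : C(K, F)) hδ] with h hh
  rw [ContinuousMap.norm_le _ (by positivity)]
  intro t
  have hht : ‖h t‖ ≤ ‖h‖ := h.norm_coe_le_norm t
  refine le_trans ?_ (mul_le_mul_of_nonneg_left hht hε.le)
  have := (convex_ball (γ t) δ).norm_image_sub_le_of_norm_hasFDerivWithin_le' (f := f)
    (f' := fderiv ℝ f) (φ := fderiv ℝ f (γ t)) (C := ε) (x := γ t) (y := γ t + h t)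
    (fun y _ => ((hf.differentiable (by simp)) y).hasFDerivAt.hasFDerivWithinAt)
    (fun y hy => by
      have := hball (y - γ t) (by simpa [dist_eq_norm] using hy) t (mem_univ t)
      simpa using this.le)
    (Metric.mem_ball_self hδ)
    (by simpa using hht.trans_lt (by simpa using hh))
  rw [add_sub_cancel_left] at this
  exact this

/-- The derivative is again a superposition operator, that of `fderiv ℝ f`, followed by a continuous
linear map. The induction thus changes the target to `F →L[ℝ] G`, which is why `F` and `G` share a
universe. -/
theorem contDiff_comp {f : F → G} (hf : ContDiff ℝ ∞ f) :
    ContDiff ℝ ∞ fun γ : C(K, F) => ContinuousMap.comp ⟨f, hf.continuous⟩ γ := by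
  refine contDiff_infty.2 fun k => ?_
  induction k generalizing G with
  | zero => exact contDiff_zero.2 (ContinuousMap.continuous_postcomp _)
  | succ k ih =>
    rw [Nat.cast_succ, contDiff_succ_iff_hasFDerivAt]
    exact ⟨_, (pointwiseApply.contDiff).comp (ih (hf.fderiv_right (m := ∞) le_rfl)),
      hasFDerivAt_comp hf⟩

end Superposition

/-! ### The exponential of a finite-dimensional space of vector fields -/

section Exponential

open scoped unitInterval

variable {n r : ℕ}

/-- The vector field `∑ᵢ vᵢ Xᵢ`. -/
noncomputable def field (X : Fin r → E n → E n) : (Fin r → ℝ) →ₗ[ℝ] E n → E n :=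
  Fintype.linearCombination ℝ X

theorem field_apply (X : Fin r → E n → E n) (v : Fin r → ℝ) (x : E n) :
    field X v x = ∑ i, v i • X i x := by
  simp [field, Fintype.linearCombination_apply, Finset.sum_apply]

theorem contDiff_field {X : Fin r → E n → E n} (hX : ∀ i, ContDiff ℝ ∞ (X i)) :
    ContDiff ℝ ∞ fun q : (Fin r → ℝ) × E n => field X q.1 q.2 := by
  simp only [field_apply]
  exact ContDiff.sum fun i _ => ContDiff.smul ((contDiff_apply ℝ ℝ i).comp contDiff_fst) ((hX i).comp contDiff_snd)

/-- The continuous map `t ↦ ∫₀ᵗ γ`. -/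
noncomputable def primitive : C(I, E n) →L[ℝ] C(I, E n) :=
  LinearMap.mkContinuous
    { toFun := fun γ => ⟨fun t => ∫ s in (0 : ℝ)..t, IccExtend zero_le_one γ s,
        (intervalIntegral.continuous_primitive
          (fun _ _ => (γ.continuous.Icc_extend' (h := zero_le_one)).intervalIntegrable _ _) 0).comp
          continuous_subtype_val⟩
      map_add' := fun γ₁ γ₂ => by
        ext1 t
        exact intervalIntegral.integral_add
          ((γ₁.continuous.Icc_extend' (h := zero_le_one)).intervalIntegrable _ _)
          ((γ₂.continuous.Icc_extend' (h := zero_le_one)).intervalIntegrable _ _)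
      map_smul' := fun c γ => by
        ext1 t
        exact intervalIntegral.integral_smul c _ }
    1 fun γ => by
    rw [ContinuousMap.norm_le _ (by positivity)]
    intro t
    refine (intervalIntegral.norm_integral_le_of_norm_le_const (C := ‖γ‖)
      fun s _ => γ.norm_coe_le_norm _).trans ?_
    rw [sub_zero, abs_of_nonneg t.2.1, one_mul]
    exact mul_le_of_le_one_right (norm_nonneg _) t.2.2

/-- The inclusion of the constant maps. -/
noncomputable def constMap : E n →L[ℝ] C(I, E n) :=
  LinearMap.mkContinuous
    { toFun := ContinuousMap.const I
      map_add' := fun _ _ => rfl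
      map_smul' := fun _ _ => rfl } 1 fun x => by
    rw [ContinuousMap.norm_le _ (by positivity), one_mul]
    exact fun _ => le_rfl

/-- Integral curves on `[0, 1]` are the solutions of `γ - ∑ᵢ vᵢ ∫ Xᵢ(γ) = x`, a smooth equation in
`(v, γ)`. At `v = 0` its derivative is the identity minus a term in `v` alone, so the inverse
function theorem yields solutions smooth in `(v, x)`. -/
theorem exists_local_exp {X : Fin r → E n → E n} (hX : ∀ i, ContDiff ℝ ∞ (X i)) (x₀ : E n) :
    ∃ δ > 0, ∃ Γ : (Fin r → ℝ) → E n → ℝ → E n,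
      (∀ v ∈ Metric.ball (0 : Fin r → ℝ) δ, ∀ x ∈ Metric.ball x₀ δ, Γ v x 0 = x ∧
        IsIntegralCurveOn (Γ v x) (fun _ => field X v) (Icc 0 1)) ∧
      ContDiffOn ℝ ∞ (fun q : (Fin r → ℝ) × E n => Γ q.1 q.2 1)
        (Metric.ball 0 δ ×ˢ Metric.ball x₀ δ) := by
  let N : Fin r → C(I, E n) → C(I, E n) := fun i γ =>
    ContinuousMap.comp ⟨X i, (hX i).continuous⟩ γ
  let γ₀ : C(I, E n) := ContinuousMap.const I x₀
  let Θ : (Fin r → ℝ) × C(I, E n) → (Fin r → ℝ) × C(I, E n) := fun q =>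
    (q.1, q.2 - ∑ i, q.1 i • primitive (N i q.2))
  have hN : ∀ i, ContDiff ℝ ∞ fun q : (Fin r → ℝ) × C(I, E n) => primitive (N i q.2) := fun i =>
    primitive.contDiff.comp ((contDiff_comp (hX i)).comp contDiff_snd)
  have hΘ : ContDiff ℝ ∞ Θ :=
    contDiff_fst.prodMk (contDiff_snd.sub (ContDiff.sum fun i _ =>
      ContDiff.smul ((contDiff_apply ℝ ℝ i).comp contDiff_fst) (hN i)))
  -- At `v = 0` differentiating the integrals themselves contributes nothing, because of the factors
  -- `vᵢ`; only the derivative of these factors remains.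
  let S : (Fin r → ℝ) × C(I, E n) →L[ℝ] C(I, E n) := ∑ i,
    ((ContinuousLinearMap.proj i).comp
      (ContinuousLinearMap.fst ℝ (Fin r → ℝ) C(I, E n))).smulRight (primitive (N i γ₀))
  have hS : ∀ v γ, S (v, γ) = S (v, 0) := fun v γ => by
    simp [S]
  have hΘ' : HasFDerivAt Θ ((ContinuousLinearMap.fst ℝ (Fin r → ℝ) C(I, E n)).prod
      (ContinuousLinearMap.snd ℝ (Fin r → ℝ) C(I, E n) - S)) (0, γ₀) := by
    refine hasFDerivAt_fst.prodMk (hasFDerivAt_snd.sub (HasFDerivAt.fun_sum fun i _ => ?_))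
    have h1 : HasFDerivAt (fun q : (Fin r → ℝ) × C(I, E n) => q.1 i)
        ((ContinuousLinearMap.proj i).comp
          (ContinuousLinearMap.fst ℝ (Fin r → ℝ) C(I, E n))) (0, γ₀) :=
      ((ContinuousLinearMap.proj i).comp
        (ContinuousLinearMap.fst ℝ (Fin r → ℝ) C(I, E n))).hasFDerivAt
    refine (h1.smul ((hN i).differentiable (by simp) (0, γ₀)).hasFDerivAt).congr_fderiv ?_
    simp
  have hinv : (fderiv ℝ Θ (0, γ₀)).IsInvertible := by
    rw [hΘ'.fderiv]
    refine ⟨ContinuousLinearEquiv.equivOfInverse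
      ((ContinuousLinearMap.fst ℝ (Fin r → ℝ) C(I, E n)).prod
        (ContinuousLinearMap.snd ℝ (Fin r → ℝ) C(I, E n) - S))
      ((ContinuousLinearMap.fst ℝ (Fin r → ℝ) C(I, E n)).prod
        (ContinuousLinearMap.snd ℝ (Fin r → ℝ) C(I, E n) + S)) ?_ ?_, rfl⟩
    · rintro ⟨v, γ⟩
      ext1
      · rfl
      · simp [hS v γ, hS v (γ - S (v, 0))]
    · rintro ⟨v, γ⟩
      ext1
      · rfl
      · simp [hS v γ, hS v (γ + S (v, 0))]
  obtain ⟨h, h0, -, heq, -, hsm⟩ := exists_smooth_local_inverse isOpen_univ hΘ.contDiffOn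
    (mem_univ (0, γ₀)) hinv
  let c : (Fin r → ℝ) × E n → (Fin r → ℝ) × C(I, E n) := fun q => (q.1, ContinuousMap.const I q.2)
  have hc : ContDiff ℝ ∞ c :=
    contDiff_fst.prodMk (constMap.contDiff.comp contDiff_snd)
  have hΘ0 : Θ (0, γ₀) = c (0, x₀) := by
    refine Prod.ext rfl ?_
    change γ₀ - ∑ i, (0 : ℝ) • primitive (N i γ₀) = γ₀
    exact (congrArg (γ₀ - ·) (Finset.sum_eq_zero fun i _ =>
      zero_smul ℝ (primitive (N i γ₀)))).trans (sub_zero γ₀)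
  have hmem : c (0, x₀) ∈ h.target := by
    rw [← hΘ0, ← heq]
    exact h.map_source h0
  obtain ⟨δ, hδ, hball⟩ := Metric.mem_nhds_iff.1
    ((h.open_target.preimage hc.continuous).mem_nhds hmem)
  rw [← ball_prod_same] at hball
  refine ⟨δ, hδ, fun v x => IccExtend zero_le_one (h.symm (c (v, x))).2, ?_, ?_⟩
  · intro v hv x hx
    set γ := (h.symm (c (v, x))).2
    have h1 : Θ (h.symm (c (v, x))) = c (v, x) :=
      (heq _).symm.trans (h.right_inv (hball (mk_mem_prod hv hx)))
    have hv1 : (h.symm (c (v, x))).1 = v := (Prod.ext_iff.1 h1).1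
    have h2 : γ - ∑ i, v i • primitive (N i γ) = ContinuousMap.const I x := by
      rw [← hv1]
      exact (Prod.ext_iff.1 h1).2
    have hcont : Continuous (IccExtend zero_le_one γ) := γ.continuous.Icc_extend'
    have h3 : ∀ t ∈ Icc (0 : ℝ) 1, IccExtend zero_le_one γ t =
        x + ∫ s in (0 : ℝ)..t, field X v (IccExtend zero_le_one γ s) := by
      intro t ht
      have h4 := DFunLike.congr_fun h2 ⟨t, ht⟩
      rw [IccExtend_of_mem _ _ ht, ← sub_eq_iff_eq_add]
      refine Eq.trans ?_ h4
      have h5 : ∫ s in (0 : ℝ)..t, field X v (IccExtend zero_le_one γ s) =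
          ∑ i, v i • ∫ s in (0 : ℝ)..t, X i (IccExtend zero_le_one γ s) := by
        simp only [field_apply]
        refine (intervalIntegral.integral_finsetSum fun i _ => Continuous.intervalIntegrable
          (((hX i).continuous.comp hcont).const_smul (v i)) _ _).trans ?_
        exact Finset.sum_congr rfl fun i _ => intervalIntegral.integral_smul (v i)
          fun s => X i (IccExtend zero_le_one γ s)
      rw [h5, ContinuousMap.sub_apply, ContinuousMap.sum_apply]
      rfl
    refine ⟨(h3 0 ⟨le_rfl, zero_le_one⟩).trans (by simp), fun t ht => ?_⟩
    have hfc : Continuous fun s => field X v (IccExtend zero_le_one γ s) :=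
      (contDiff_field hX).continuous.comp (continuous_const.prodMk hcont)
    exact (((hfc.integral_hasStrictDerivAt 0 t).hasDerivAt.const_add x).hasDerivWithinAt).congr
      h3 (h3 t ht)
  · have h1 : ContDiffOn ℝ ∞ (fun q : (Fin r → ℝ) × E n => h.symm (c q))
        (Metric.ball 0 δ ×ˢ Metric.ball x₀ δ) := hsm.comp hc.contDiffOn hball
    have h2 := ((ContinuousMap.evalCLM ℝ (1 : I) : C(I, E n) →L[ℝ] E n).contDiff.comp
      contDiff_snd).comp_contDiffOn h1
    refine h2.congr fun q _ => ?_
    exact IccExtend_of_mem _ _ (right_mem_Icc.2 zero_le_one)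

end Exponential

/-! ### Gluing the local exponentials over all base points -/

section GlobalExponential

variable {n r : ℕ} {X : Fin r → E n → E n}

/-- `e(v, x)` is the value at time `1` of the integral curve of `∑ᵢ vᵢ Xᵢ` starting at `x`, on an
open neighbourhood of `{0} × ℝⁿ` that is star-shaped in `v`. -/
structure IsExponential (X : Fin r → E n → E n) (dom : Set ((Fin r → ℝ) × E n))
    (e : (Fin r → ℝ) × E n → E n) : Prop where
  isOpen : IsOpen dom
  zero_mem : ∀ x, (0, x) ∈ dom
  smul_mem : ∀ v x, (v, x) ∈ dom → ∀ s ∈ Icc (0 : ℝ) 1, (s • v, x) ∈ dom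
  contDiffOn : ContDiffOn ℝ ∞ e dom
  map_zero : ∀ x, e (0, x) = x
  radial : ∀ v x, (v, x) ∈ dom → ∀ s ∈ Icc (0 : ℝ) 1,
    fderiv ℝ e (s • v, x) (v, 0) = field X v (e (s • v, x))

theorem isSmoothTimeDep_field (hX : ∀ i, ContDiff ℝ ∞ (X i)) (v : Fin r → ℝ) :
    IsSmoothTimeDep fun _ => field X v :=
  (contDiff_field hX).comp (contDiff_const.prodMk contDiff_snd)

theorem isIntegralCurveOn_rescale {v : Fin r → ℝ} {γ : ℝ → E n}
    (hγ : IsIntegralCurveOn γ (fun _ => field X v) (Icc 0 1)) {s : ℝ} (hs : s ∈ Icc (0 : ℝ) 1) :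
    IsIntegralCurveOn (fun t => γ (t * s)) (fun _ => field X (s • v)) (Icc 0 1) := by
  intro t ht
  have hmaps : MapsTo (fun t => t * s) (Icc (0 : ℝ) 1) (Icc 0 1) := fun t ht =>
    ⟨mul_nonneg ht.1 hs.1, mul_le_one₀ ht.2 hs.1 hs.2⟩
  have h1 : HasDerivWithinAt (fun t : ℝ => t * s) s (Icc 0 1) t := by
    simpa using ((hasDerivAt_id t).mul_const s).hasDerivWithinAt
  have h2 := (hγ (t * s) (hmaps ht)).scomp t h1 hmaps
  rw [_root_.map_smul]
  exact h2

/-- By uniqueness the local exponentials agree where they overlap, whichever base point is chosen.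
Rescaling time identifies `e (s • v, x)` with the curve for `v` at time `s`, which gives the radial
equation. -/
theorem exists_isExponential (hX : ∀ i, ContDiff ℝ ∞ (X i)) :
    ∃ dom e, IsExponential X dom e := by
  classical
  choose δ hδ Γ hΓ hsm using exists_local_exp hX
  let P : (Fin r → ℝ) × E n → E n → Prop := fun q x₀ =>
    q.1 ∈ Metric.ball 0 (δ x₀) ∧ q.2 ∈ Metric.ball x₀ (δ x₀)
  let e : (Fin r → ℝ) × E n → E n := fun q =>
    if h : ∃ x₀, P q x₀ then Γ h.choose q.1 q.2 1 else 0
  have hsmul : ∀ v x x₀, P (v, x) x₀ → ∀ s ∈ Icc (0 : ℝ) 1, P (s • v, x) x₀ := by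
    rintro v x x₀ ⟨hv, hx⟩ s hs
    refine ⟨?_, hx⟩
    rw [mem_ball_zero_iff] at hv ⊢
    refine lt_of_le_of_lt ?_ hv
    rw [norm_smul, Real.norm_of_nonneg hs.1]
    exact mul_le_of_le_one_left (norm_nonneg _) hs.2
  have he : ∀ v x x₀, P (v, x) x₀ → ∀ s ∈ Icc (0 : ℝ) 1, e (s • v, x) = Γ x₀ v x s := by
    intro v x x₀ hP s hs
    have hex : ∃ x₀, P (s • v, x) x₀ := ⟨x₀, hsmul v x x₀ hP s hs⟩
    have h1 : e (s • v, x) = Γ hex.choose (s • v) x 1 := dif_pos hex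
    rw [h1]
    have h2 := hΓ hex.choose _ hex.choose_spec.1 _ hex.choose_spec.2
    have h3 := hΓ x₀ v hP.1 x hP.2
    have h4 := eqOn_of_isSmoothTimeDep (isSmoothTimeDep_field hX (s • v)) ordConnected_Icc
      h2.2 (isIntegralCurveOn_rescale h3.2 hs) (left_mem_Icc.2 zero_le_one)
      (by rw [h2.1, zero_mul, h3.1]) (right_mem_Icc.2 zero_le_one)
    simpa using h4
  have he1 : ∀ v x x₀, P (v, x) x₀ → e (v, x) = Γ x₀ v x 1 := fun v x x₀ hP => by
    simpa using he v x x₀ hP 1 (right_mem_Icc.2 zero_le_one)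
  have hPopen : ∀ x₀, IsOpen {q | P q x₀} := fun x₀ => Metric.isOpen_ball.prod Metric.isOpen_ball
  have hcd : ∀ q x₀, P q x₀ → ContDiffAt ℝ ∞ e q := fun q x₀ hP =>
    ((hsm x₀).congr fun q hq => he1 q.1 q.2 x₀ hq).contDiffAt ((hPopen x₀).mem_nhds hP)
  have hP0 : ∀ x, P (0, x) x := fun x =>
    ⟨Metric.mem_ball_self (hδ x), Metric.mem_ball_self (hδ x)⟩
  refine ⟨{q | ∃ x₀, P q x₀}, e, ?_, fun x => ⟨x, hP0 x⟩, ?_, ?_, ?_, ?_⟩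
  · simp only [ofPred_exists]
    exact isOpen_iUnion hPopen
  · rintro v x ⟨x₀, hP⟩ s hs
    exact ⟨x₀, hsmul v x x₀ hP s hs⟩
  · rintro q ⟨x₀, hP⟩
    exact (hcd q x₀ hP).contDiffWithinAt
  · intro x
    have h := he 0 x x (hP0 x) 0 (left_mem_Icc.2 zero_le_one)
    rw [smul_zero] at h
    exact h.trans (hΓ x 0 (hP0 x).1 x (hP0 x).2).1
  · rintro v x ⟨x₀, hP⟩ s hs
    have h1 : HasDerivAt (fun s : ℝ => e (s • v, x)) (fderiv ℝ e (s • v, x) (v, 0)) s :=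
      hasDerivAt_comp_pair (x := fun s : ℝ => s • v) (y := fun _ => x)
        ((hcd _ x₀ (hsmul v x x₀ hP s hs)).differentiableAt (by simp)).hasFDerivAt
        (by simpa using (hasDerivAt_id s).smul_const v) (hasDerivAt_const s x)
    have h2 := ((hΓ x₀ v hP.1 x hP.2).2 s hs).congr (fun t ht => he v x x₀ hP t ht)
      (he v x x₀ hP s hs)
    rw [he v x x₀ hP s hs]
    exact (uniqueDiffOn_Icc zero_lt_one s hs).eq_deriv _ h1.hasDerivWithinAt h2

variable {dom : Set ((Fin r → ℝ) × E n)} {e : (Fin r → ℝ) × E n → E n}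

namespace IsExponential

theorem contDiffAt (he : IsExponential X dom e) {q} (hq : q ∈ dom) : ContDiffAt ℝ ∞ e q :=
  he.contDiffOn.contDiffAt (he.isOpen.mem_nhds hq)

theorem hasFDerivAt (he : IsExponential X dom e) {q} (hq : q ∈ dom) :
    HasFDerivAt e (fderiv ℝ e q) q :=
  ((he.contDiffAt hq).differentiableAt (by simp)).hasFDerivAt

theorem radial_one (he : IsExponential X dom e) {q} (hq : q ∈ dom) :
    fderiv ℝ e q (q.1, 0) = field X q.1 (e q) := by
  simpa using he.radial q.1 q.2 hq 1 (right_mem_Icc.2 zero_le_one)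

/-- `(v, x)` may lie outside the domain, but `(s • v, x)` lies in it for small `s ≠ 0`, and both
sides are linear in `v`. -/
theorem radial_zero (he : IsExponential X dom e) (v : Fin r → ℝ) (x : E n) :
    fderiv ℝ e (0, x) (v, 0) = field X v x := by
  have hc : Continuous fun s : ℝ => (s • v, x) := by fun_prop
  have hev : ∀ᶠ s : ℝ in 𝓝 0, (s • v, x) ∈ dom :=
    hc.continuousAt.preimage_mem_nhds (he.isOpen.mem_nhds (by simpa using he.zero_mem x))
  obtain ⟨s, hs, hs0⟩ := ((hev.filter_mono nhdsWithin_le_nhds).and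
    (self_mem_nhdsWithin : {(0 : ℝ)}ᶜ ∈ 𝓝[≠] (0 : ℝ))).exists
  have h := he.radial _ x hs 0 (left_mem_Icc.2 zero_le_one)
  rw [zero_smul, he.map_zero, _root_.map_smul] at h
  have h2 : ((s • v, 0) : (Fin r → ℝ) × E n) = s • (v, 0) := by simp
  rw [h2, _root_.map_smul] at h
  exact smul_right_injective _ hs0 h

theorem radial_smul (he : IsExponential X dom e) {v : Fin r → ℝ} {x : E n} {s : ℝ}
    (hs : (s • v, x) ∈ dom) : fderiv ℝ e (s • v, x) (v, 0) = field X v (e (s • v, x)) := by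
  rcases eq_or_ne s 0 with rfl | hs0
  · rw [zero_smul, he.map_zero, he.radial_zero]
  · have h := he.radial_one hs
    have h2 : ((s • v, 0) : (Fin r → ℝ) × E n) = s • (v, 0) := by simp
    simp only [h2, _root_.map_smul] at h
    exact smul_right_injective _ hs0 h

theorem fderiv_zero_space (he : IsExponential X dom e) (x ξ : E n) :
    fderiv ℝ e (0, x) (0, ξ) = ξ := by
  have h1 := (he.hasFDerivAt (he.zero_mem x)).comp x (hasFDerivAt_prodMk_right 0 x)
  have h2 : (e ∘ fun y => (0, y)) = id := funext fun y => he.map_zero y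
  rw [h2] at h1
  simpa using DFunLike.congr_fun (h1.unique (hasFDerivAt_id x)) ξ

/-- The flow of `∑ᵢ vᵢ Xᵢ` in terms of the exponential. -/
theorem isFlowOf (he : IsExponential X dom e) (v : Fin r → ℝ) :
    PartialFlow.IsFlowOf ⟨{q | (q.1 • v, q.2) ∈ dom}, fun s x => e (s • v, x)⟩
      (fun _ => field X v) where
  isOpen_dom := he.isOpen.preimage (f := fun q : ℝ × E n => (q.1 • v, q.2)) (by fun_prop)
  zero_mem x := by simpa using he.zero_mem x
  ordConnected x := by
    have h0 : ∀ s : ℝ, (s • v, x) ∈ dom → uIcc 0 s ⊆ {t : ℝ | (t • v, x) ∈ dom} := by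
      intro s hs t ht
      rcases eq_or_ne s 0 with rfl | hs0
      · simp only [uIcc_self, mem_singleton_iff] at ht
        simpa [ht] using hs
      · have h1 := he.smul_mem _ x hs (t / s) (by
          rcases le_total 0 s with h | h
          · rw [uIcc_of_le h] at ht
            exact ⟨div_nonneg ht.1 h, div_le_one_of_le₀ ht.2 h⟩
          · rw [uIcc_of_ge h] at ht
            exact ⟨div_nonneg_of_nonpos ht.2 h, div_le_one_of_ge ht.1 h⟩)
        rwa [smul_smul, div_mul_cancel₀ t hs0] at h1
    refine ordConnected_of_uIcc_subset_left (x := 0) fun s hs => h0 s hs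
  smooth := he.contDiffOn.comp (f := fun q : ℝ × E n => (q.1 • v, q.2))
    (ContDiff.contDiffOn (by fun_prop)) fun _ hq => hq
  map_zero x := by simpa using he.map_zero x
  integralCurve x s hs := by
    have h1 : HasDerivAt (fun s : ℝ => e (s • v, x)) (fderiv ℝ e (s • v, x) (v, 0)) s :=
      hasDerivAt_comp_pair (x := fun s : ℝ => s • v) (y := fun _ => x) (he.hasFDerivAt hs)
        (by simpa using (hasDerivAt_id s).smul_const v) (hasDerivAt_const s x)
    rw [he.radial_smul hs] at h1
    exact h1.hasDerivWithinAt

theorem isInvertible_fderiv_space (hX : ∀ i, ContDiff ℝ ∞ (X i)) (he : IsExponential X dom e)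
    {v : Fin r → ℝ} {x : E n} (hq : (v, x) ∈ dom) :
    (fderiv ℝ (fun k => e (v, k)) x).IsInvertible := by
  have := (he.isFlowOf v).isInvertible_fderiv (isSmoothTimeDep_field hX v) (t := 1) (x := x)
    (by simpa using hq)
  simpa using this

end IsExponential

end GlobalExponential

/-! ### The derivative of the exponential with respect to the vector field -/

/-- The solution operator of `c' = w - A c`, `c(0) = 0`. -/
theorem exists_linear_solution {P : Type*} [NormedAddCommGroup P] [NormedSpace ℝ P]
    [CompleteSpace P] (A : P →L[ℝ] P) :
    ∃ C : ℝ → P →L[ℝ] P, C 0 = 0 ∧ ∀ w s, HasDerivAt (fun s => C s w) (w - A (C s w)) s := by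
  -- Carrying `w` as a constant second component makes the equation homogeneous, so an operator
  -- exponential solves it.
  let B : P × P →L[ℝ] P × P :=
    (ContinuousLinearMap.snd ℝ P P - A.comp (ContinuousLinearMap.fst ℝ P P)).prod 0
  let Y : ℝ → P → P × P := fun s w => NormedSpace.exp (s • B) (0, w)
  have hY : ∀ w s, HasDerivAt (fun s => Y s w) (B (Y s w)) s := fun w s => by
    have h := (hasDerivAt_exp_smul_const' (𝕂 := ℝ) B s).clm_apply (hasDerivAt_const s ((0 : P), w))
    simpa [Y] using h
  have hY0 : ∀ w, Y 0 w = (0, w) := fun w => by simp [Y]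
  have hY2 : ∀ w s, (Y s w).2 = w := fun w s => by
    have h : ∀ s, HasDerivAt (fun s => (Y s w).2) 0 s := fun s => (hY w s).snd
    have := is_const_of_deriv_eq_zero (fun s => (h s).differentiableAt) (fun s => (h s).deriv) s 0
    rw [this, hY0]
  refine ⟨fun s => (ContinuousLinearMap.fst ℝ P P).comp
    ((NormedSpace.exp (s • B)).comp (ContinuousLinearMap.inr ℝ P P)), ?_, fun w s => ?_⟩
  · ext w
    simp
  · have h : HasDerivAt (fun s => (Y s w).1) (B (Y s w)).1 s := (hY w s).fst
    have h2 : (B (Y s w)).1 = w - A (Y s w).1 := by simp [B, hY2]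
    rw [h2] at h
    exact h

variable {n r : ℕ} {X : Fin r → E n → E n} {dom : Set ((Fin r → ℝ) × E n)}
  {e : (Fin r → ℝ) × E n → E n}

theorem contDiff_field_apply (hX : ∀ i, ContDiff ℝ ∞ (X i)) (v : Fin r → ℝ) :
    ContDiff ℝ ∞ (field X v) :=
  (contDiff_field hX).comp (contDiff_prodMk_right v)

theorem exists_hasFDerivAt_field (hX : ∀ i, ContDiff ℝ ∞ (X i)) (v : Fin r → ℝ) (y : E n) :
    ∃ L : (Fin r → ℝ) × E n →L[ℝ] E n,
      HasFDerivAt (fun q : (Fin r → ℝ) × E n => field X q.1 q.2) L (v, y) ∧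
      ∀ w η, L (w, η) = field X w y + fderiv ℝ (field X v) y η := by
  have h := ((contDiff_field hX).differentiable (by simp) (v, y)).hasFDerivAt
  refine ⟨_, h, fun w η => ?_⟩
  have hlin : HasFDerivAt (fun v => field X v y) (LinearMap.toContinuousLinearMap
      ((LinearMap.proj y : (E n → E n) →ₗ[ℝ] E n) ∘ₗ field X)) v :=
    (LinearMap.toContinuousLinearMap
      ((LinearMap.proj y : (E n → E n) →ₗ[ℝ] E n) ∘ₗ field X)).hasFDerivAt
  have h1 := (h.comp y (hasFDerivAt_prodMk_right v y)).unique
    ((contDiff_field_apply hX v).differentiable (by simp) y).hasFDerivAt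
  have h2 := (HasFDerivAt.comp v (f := fun v => (v, y)) h (hasFDerivAt_prodMk_left v y)).unique
    hlin
  have h3 := DFunLike.congr_fun h1 η
  have h4 := DFunLike.congr_fun h2 w
  simp only [ContinuousLinearMap.comp_apply, ContinuousLinearMap.inr_apply,
    ContinuousLinearMap.inl_apply] at h3 h4
  rw [← h3, show (w, η) = (w, (0 : E n)) + (0, η) by simp, map_add, h4]
  rfl

/-- The derivative of the exponential in the direction of the vector field is an element of the
Lie algebra that does not depend on the point. -/
theorem IsExponential.exists_fderiv_param (hX : ∀ i, ContDiff ℝ ∞ (X i))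
    (he : IsExponential X dom e) {v : Fin r → ℝ} (A : (Fin r → ℝ) →L[ℝ] Fin r → ℝ)
    (hA : ∀ c, VectorField.lieBracket ℝ (field X v) (field X c) = field X (A c)) :
    ∃ ψ : (Fin r → ℝ) →L[ℝ] Fin r → ℝ, ∀ x w, (v, x) ∈ dom →
      fderiv ℝ e (v, x) (w, 0) = field X (ψ w) (e (v, x)) := by
  obtain ⟨C, hC0, hC⟩ := exists_linear_solution A
  refine ⟨C 1, fun x w hvx => ?_⟩
  have hdom : ∀ s ∈ Icc (0 : ℝ) 1, (s • v, x) ∈ dom := he.smul_mem v x hvx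
  set φ : ℝ → E n := fun s => e (s • v, x) with hφ
  have hline : ∀ s : ℝ, HasDerivAt (fun s : ℝ => s • v) v s := fun s => by
    simpa using (hasDerivAt_id s).smul_const v
  have hφ' : ∀ s ∈ Icc (0 : ℝ) 1, HasDerivAt φ (field X v (φ s)) s := fun s hs => by
    rw [hφ, ← he.radial v x hvx s hs]
    exact hasDerivAt_comp_pair (x := fun s : ℝ => s • v) (y := fun _ => x)
      (he.hasFDerivAt (hdom s hs)) (hline s) (hasDerivAt_const s x)
  -- The curves in `hu` and `hc` solve the same inhomogeneous linear equation and both vanish at `s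
  -- = 0`; equality at `s = 1` is the claim. `C` depends on `A` only, hence not on `x`.
  have hu : ∀ s ∈ Icc (0 : ℝ) 1, HasDerivAt (fun s : ℝ => s • fderiv ℝ e (s • v, x) (w, 0))
      (fderiv ℝ (field X v) (φ s) (s • fderiv ℝ e (s • v, x) (w, 0)) + field X w (φ s)) s := by
    intro s hs
    obtain ⟨D, hD, hsymm, hDv⟩ := exists_second_fderiv (he.contDiffAt (hdom s hs))
    have h1 : HasDerivAt (fun s : ℝ => fderiv ℝ e (s • v, x) (w, 0)) (D (w, 0) (v, 0)) s :=
      hasDerivAt_comp_pair (x := fun s : ℝ => s • v) (y := fun _ => x) (hDv (w, 0))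
        (hline s) (hasDerivAt_const s x)
    have h2 := (hasDerivAt_id' s).smul h1
    refine h2.congr_deriv ?_
    obtain ⟨L, hL, hLapp⟩ := exists_hasFDerivAt_field hX (s • v) (φ s)
    have h3 : HasFDerivAt (fun q : (Fin r → ℝ) × E n => field X q.1 (e q))
        (L.comp ((ContinuousLinearMap.fst ℝ _ _).prod (fderiv ℝ e (s • v, x)))) (s • v, x) :=
      HasFDerivAt.comp (s • v, x) (f := fun q : (Fin r → ℝ) × E n => (q.1, e q)) hL
        (hasFDerivAt_fst.prodMk (he.hasFDerivAt (hdom s hs)))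
    -- Differentiating the radial identity `De(q)(q.1, 0) = field X q.1 (e q)` in the direction `(w,
    -- 0)` expresses the mixed second derivative.
    have h4 := hD.clm_apply (((ContinuousLinearMap.fst ℝ (Fin r → ℝ) (E n)).prod
      (0 : (Fin r → ℝ) × E n →L[ℝ] E n)).hasFDerivAt (x := (s • v, x)))
    have h5 : (fun q => fderiv ℝ e q (((ContinuousLinearMap.fst ℝ (Fin r → ℝ) (E n)).prod
        (0 : (Fin r → ℝ) × E n →L[ℝ] E n)) q)) =ᶠ[𝓝 (s • v, x)]
        fun q => field X q.1 (e q) := by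
      filter_upwards [he.isOpen.mem_nhds (hdom s hs)] with q hq using he.radial_one hq
    have h6 := DFunLike.congr_fun ((h5.hasFDerivAt_iff.1 h4).unique h3) (w, (0 : E n))
    have h7 : fderiv ℝ (field X (s • v)) (φ s) = s • fderiv ℝ (field X v) (φ s) := by
      rw [_root_.map_smul]
      exact fderiv_const_smul ((contDiff_field_apply hX v).differentiable (by simp) _) s
    have hLapp' : ∀ w η, L (w, η) = field X w (φ s) + s • fderiv ℝ (field X v) (φ s) η :=
      fun w η => by rw [hLapp, h7]; rfl
    have h8 : ((s • v, 0) : (Fin r → ℝ) × E n) = s • (v, 0) := by simp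
    simp only [_root_.add_apply, ContinuousLinearMap.comp_apply,
      ContinuousLinearMap.prod_apply,
      ContinuousLinearMap.coe_fst', _root_.zero_apply, hLapp', h8,
      _root_.map_smul] at h6
    rw [_root_.map_smul, add_comm (s • _) (field X w _), ← h6, one_smul]
    exact add_comm _ _
  have hc : ∀ s ∈ Icc (0 : ℝ) 1, HasDerivAt (fun s => field X (C s w) (φ s))
      (fderiv ℝ (field X v) (φ s) (field X (C s w) (φ s)) + field X w (φ s)) s := by
    intro s hs
    obtain ⟨L, hL, hLapp⟩ := exists_hasFDerivAt_field hX (C s w) (φ s)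
    refine (hasDerivAt_comp_pair hL (hC w s) (hφ' s hs)).congr_deriv ?_
    -- The term `-A (C s w)` is minus the bracket, which trades the derivative of `field X (C s w)`
    -- along `field X v` for that of `field X v` along `field X (C s w)`.
    have h1 := congrFun (hA (C s w)) (φ s)
    rw [VectorField.lieBracket_eq] at h1
    rw [hLapp, map_sub, Pi.sub_apply, ← h1, sub_add_eq_add_sub, add_sub_assoc, sub_sub_cancel, add_comm]
  have hcont : ContinuousOn (fun s => fderiv ℝ (field X v) (φ s)) (Icc 0 1) :=
    ((contDiff_field_apply hX v).continuous_fderiv (by simp)).comp_continuousOn fun s hs =>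
      (hφ' s hs).continuousAt.continuousWithinAt
  have := eqOn_of_linear (B := fun s => field X w (φ s)) ordConnected_Icc hcont
    (fun s hs => (hu s hs).hasDerivWithinAt) (fun s hs => (hc s hs).hasDerivWithinAt)
    (left_mem_Icc.2 zero_le_one) (by simp [hC0]) (right_mem_Icc.2 zero_le_one)
  simpa [hφ] using this

/-! ### Existence of superposition rules for finite-dimensional Lie algebras -/

section LieTheorem

variable {n r m : ℕ} {X : Fin r → E n → E n} {dom : Set ((Fin r → ℝ) × E n)}
  {e : (Fin r → ℝ) × E n → E n}

/-- The diagonal prolongations at `p` of the vector fields `∑ᵢ vᵢ Xᵢ`. -/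
noncomputable def prolongation (X : Fin r → E n → E n) (p : Fin m → E n) :
    (Fin r → ℝ) →ₗ[ℝ] Fin m → E n :=
  LinearMap.pi fun a => LinearMap.proj (p a) ∘ₗ field X

theorem prolongation_apply (p : Fin m → E n) (v : Fin r → ℝ) (a : Fin m) :
    prolongation X p v a = field X v (p a) := rfl

/-- By homogeneity it suffices to test `v` on the unit sphere, and nonvanishing on a compact set is
an open condition in `p`. -/
theorem isOpen_injective_prolongation (hX : ∀ i, ContDiff ℝ ∞ (X i)) :
    IsOpen {p : Fin m → E n | ∀ v, prolongation X p v = 0 → v = 0} := by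
  have heq : {p : Fin m → E n | ∀ v, prolongation X p v = 0 → v = 0} =
      {p | ∀ v ∈ Metric.sphere (0 : Fin r → ℝ) 1, prolongation X p v ≠ 0} := by
    ext p
    refine ⟨fun h v hv h0 => ?_, fun h v h0 => ?_⟩
    · rw [h v h0] at hv
      simp at hv
    · by_contra hv
      refine h (‖v‖⁻¹ • v) ?_ (by rw [map_smul, h0, smul_zero])
      rw [mem_sphere_zero_iff_norm, norm_smul, norm_inv, norm_norm,
        inv_mul_cancel₀ (norm_ne_zero_iff.2 hv)]
  rw [heq, isOpen_iff_eventually]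
  intro p hp
  refine (isCompact_sphere (0 : Fin r → ℝ) 1).eventually_forall_of_forall_eventually
    fun v hv => ?_
  have hc : Continuous fun z : (Fin m → E n) × (Fin r → ℝ) => prolongation X z.1 z.2 :=
    continuous_pi fun a => (contDiff_field hX).continuous.comp
      (f := fun z : (Fin m → E n) × (Fin r → ℝ) => (z.2, z.1 a)) (by fun_prop)
  exact hc.continuousAt.eventually_ne (hp v hv)

/-- The map `(v, s) ↦ (exp(v)(p₁ + s₁), …, exp(v)(p_m + s_m))`. -/
def orbitMap (e : (Fin r → ℝ) × E n → E n) (p : Fin m → E n) (S : Submodule ℝ (Fin m → E n))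
    (q : (Fin r → ℝ) × S) : Fin m → E n :=
  fun a => e (q.1, p a + (q.2 : Fin m → E n) a)

/-- The domain of `orbitMap`. -/
def orbitDom (dom : Set ((Fin r → ℝ) × E n)) (p : Fin m → E n) (S : Submodule ℝ (Fin m → E n)) :
    Set ((Fin r → ℝ) × S) :=
  {q | ∀ a, (q.1, p a + (q.2 : Fin m → E n) a) ∈ dom}

variable {p : Fin m → E n} {S : Submodule ℝ (Fin m → E n)}

/-- The affine map `(v, s) ↦ (v, pₐ + sₐ)`. -/
theorem contDiff_orbit_component (a : Fin m) :
    ContDiff ℝ ∞ fun q : (Fin r → ℝ) × S => (q.1, p a + (q.2 : Fin m → E n) a) :=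
  contDiff_fst.prodMk (contDiff_const.add
    (((ContinuousLinearMap.proj (R := ℝ) (φ := fun _ : Fin m => E n) a).comp
      S.subtypeL).contDiff.comp contDiff_snd))

namespace IsExponential

theorem isOpen_orbitDom (he : IsExponential X dom e) : IsOpen (orbitDom dom p S) := by
  simp only [orbitDom, ofPred_forall]
  exact isOpen_iInter_of_finite fun a => he.isOpen.preimage (contDiff_orbit_component a).continuous

theorem contDiffOn_orbitMap (he : IsExponential X dom e) :
    ContDiffOn ℝ ∞ (orbitMap e p S) (orbitDom dom p S) :=
  contDiffOn_pi.2 fun a =>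
    he.contDiffOn.comp (contDiff_orbit_component a).contDiffOn fun _ hq => hq a

theorem fderiv_orbitMap (he : IsExponential X dom e) {q : (Fin r → ℝ) × S}
    (hq : q ∈ orbitDom dom p S) (w : Fin r → ℝ) (σ : S) (a : Fin m) :
    fderiv ℝ (orbitMap e p S) q (w, σ) a =
      fderiv ℝ e (q.1, p a + (q.2 : Fin m → E n) a) (w, (σ : Fin m → E n) a) := by
  have hd : HasFDerivAt (orbitMap e p S) (fderiv ℝ (orbitMap e p S) q) q :=
    ((he.contDiffOn_orbitMap.contDiffAt (he.isOpen_orbitDom.mem_nhds hq)).differentiableAt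
      (by simp)).hasFDerivAt
  have h1 : HasFDerivAt (fun q : (Fin r → ℝ) × S => (q.1, p a + (q.2 : Fin m → E n) a))
      ((ContinuousLinearMap.fst ℝ (Fin r → ℝ) S).prod
        (((ContinuousLinearMap.proj (R := ℝ) (φ := fun _ : Fin m => E n) a).comp
          S.subtypeL).comp (ContinuousLinearMap.snd ℝ (Fin r → ℝ) S))) q :=
    hasFDerivAt_fst.prodMk
      (((((ContinuousLinearMap.proj (R := ℝ) (φ := fun _ : Fin m => E n) a).comp
        S.subtypeL).comp (ContinuousLinearMap.snd ℝ (Fin r → ℝ) S)).hasFDerivAt).const_add (p a))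
  have h2 := HasFDerivAt.comp q (he.hasFDerivAt (hq a)) h1
  exact DFunLike.congr_fun ((hasFDerivAt_pi'.1 hd a).unique h2) (w, σ)

theorem orbitMap_zero (he : IsExponential X dom e) : orbitMap e p S (0, 0) = p := by
  ext1 a
  simp [orbitMap, he.map_zero]

theorem zero_mem_orbitDom (he : IsExponential X dom e) : (0, 0) ∈ orbitDom dom p S :=
  fun _ => he.zero_mem _

/-- At the origin the derivative is `(w, σ) ↦ prolongation X p w + σ`, an isomorphism because `S`
complements the range of an injective map. -/
theorem isInvertible_fderiv_orbitMap (he : IsExponential X dom e)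
    (hp : ∀ v, prolongation X p v = 0 → v = 0)
    (hS : IsCompl (LinearMap.range (prolongation X p)) S) :
    (fderiv ℝ (orbitMap e p S) (0, 0)).IsInvertible := by
  refine isInvertible_of_injective ?_ ?_
  · rw [Module.finrank_prod, ← Submodule.finrank_add_eq_of_isCompl hS, LinearMap.finrank_range_of_inj
      ((injective_iff_map_eq_zero (prolongation X p)).2 hp)]
  · rintro ⟨w, σ⟩ h
    have h1 : prolongation X p w + (σ : Fin m → E n) = 0 := by
      ext1 a
      have h2 := congrFun h a
      rw [he.fderiv_orbitMap he.zero_mem_orbitDom,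
        show (w, (σ : Fin m → E n) a) = (w, (0 : E n)) + (0, (σ : Fin m → E n) a) by simp,
        map_add, he.radial_zero, he.fderiv_zero_space] at h2
      simpa [prolongation_apply] using h2
    have h2 : (σ : Fin m → E n) = 0 := by
      refine Submodule.disjoint_def.1 hS.disjoint _ ?_ σ.2
      rw [eq_neg_of_add_eq_zero_right h1]
      exact Submodule.neg_mem _ ⟨w, rfl⟩
    rw [h2, add_zero] at h1
    rw [hp w h1, Subtype.ext (a1 := σ) (a2 := 0) h2]
    rfl

end IsExponential

/-- Lie's theorem: near an `m`-tuple `p` at which the prolongations are independent there is a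
superposition rule, complete at `p`. -/
theorem exists_superposition_rule (hX : ∀ i, ContDiff ℝ ∞ (X i))
    (hlie : ∀ v, ∃ A : (Fin r → ℝ) →L[ℝ] Fin r → ℝ, ∀ c,
      VectorField.lieBracket ℝ (field X v) (field X c) = field X (A c))
    {p : Fin m → E n} (hp : ∀ v, prolongation X p v = 0 → v = 0)
    {V₀ : Submodule ℝ (E n → E n)} (hV₀ : ∀ v ∈ V₀, ∃ b, field X b = v) :
    ∃ (Φ : (Fin m → E n) → E n → E n) (D : Set ((Fin m → E n) × E n)),
      IsLieSuperpositionRule V₀ Φ D ∧ IsCompleteAt (constRule Φ) (constDom D) p := by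
  obtain ⟨dom, e, he⟩ := exists_isExponential hX
  obtain ⟨S, hS⟩ := Submodule.exists_isCompl (LinearMap.range (prolongation X p))
  obtain ⟨h, h0, hsub, heq, hinv, hsm⟩ := exists_smooth_local_inverse he.isOpen_orbitDom
    he.contDiffOn_orbitMap (he.zero_mem_orbitDom (p := p) (S := S))
    (he.isInvertible_fderiv_orbitMap hp hS)
  -- The `m` solutions determine the group parameter `v`; the rule lets `exp(v)` act on `k`.
  let c : (Fin m → E n) × E n → (Fin r → ℝ) × E n := fun q => ((h.symm q.1).1, q.2)
  have hT : IsOpen {q : (Fin m → E n) × E n | q.1 ∈ h.target} := h.open_target.preimage continuous_fst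
  have hc : ContDiffOn ℝ ∞ c {q | q.1 ∈ h.target} :=
    (contDiff_fst.comp_contDiffOn (hsm.comp contDiffOn_fst fun _ hq => hq)).prodMk contDiffOn_snd
  let Φ : (Fin m → E n) → E n → E n := fun x k => e (c (x, k))
  let D : Set ((Fin m → E n) × E n) := {q | q.1 ∈ h.target} ∩ c ⁻¹' dom
  have hD : IsOpen D := hc.continuousOn.isOpen_inter_preimage hT he.isOpen
  have hpt : p ∈ h.target := by
    have := h.map_source h0
    rwa [heq, he.orbitMap_zero] at this
  have hp0 : h.symm p = (0, 0) := by
    have := h.left_inv h0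
    rwa [heq, he.orbitMap_zero] at this
  have hcp : ∀ k, c (p, k) = (0, k) := fun k => by simp [c, hp0]
  have hDp : ∀ k, (p, k) ∈ D := fun k => ⟨hpt, by
    rw [mem_preimage, hcp]
    exact he.zero_mem k⟩
  have hΦp : ∀ k, Φ p k = k := fun k => by
    change e (c (p, k)) = k
    rw [hcp, he.map_zero]
  have hsol : ∀ Y ∈ timeDep V₀, ∀ I : Set ℝ, IsOpen I → I.OrdConnected →
      ∀ x : Fin m → ℝ → E n, (∀ a, IsIntegralCurveOn (x a) Y I) →
      ∀ k, (∀ t ∈ I, (t, (fun a => x a t), k) ∈ constDom D) →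
        IsIntegralCurveOn (fun t => constRule Φ t (fun a => x a t) k) Y I := by
    intro Y hY I hI _ x hx k hk t ht
    refine HasDerivAt.hasDerivWithinAt ?_
    obtain ⟨b, hb⟩ := hV₀ _ (hY.2 t)
    obtain ⟨htgt, hdom⟩ : (fun a => x a t) ∈ h.target ∧ c (fun a => x a t, k) ∈ dom := hk t ht
    have hx' : HasDerivAt (fun s a => x a s) (fun a => Y t (x a t)) t :=
      hasDerivAt_pi.2 fun a => (hx a t ht).hasDerivAt (hI.mem_nhds ht)
    set q : ℝ → (Fin r → ℝ) × S := fun s => h.symm fun a => x a s with hq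
    have hqs : q t ∈ h.source := h.map_target htgt
    have hqd : HasDerivAt q (deriv q t) t :=
      (DifferentiableAt.comp t (((hsm.contDiffAt (h.open_target.mem_nhds htgt)).differentiableAt
        (by simp))) hx'.differentiableAt).hasDerivAt
    have horb : ∀ a, e ((q t).1, p a + ((q t).2 : Fin m → E n) a) = x a t := fun a =>
      congrFun ((heq _).symm.trans (h.right_inv htgt)) a
    have h1 : HasDerivAt (fun s => orbitMap e p S (q s))
        (fderiv ℝ (orbitMap e p S) (q t) (deriv q t)) t :=
      (((he.contDiffOn_orbitMap.contDiffAt (he.isOpen_orbitDom.mem_nhds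
        (hsub hqs))).differentiableAt (by simp)).hasFDerivAt).comp_hasDerivAt t hqd
    have h2 : (fun s => orbitMap e p S (q s)) =ᶠ[𝓝 t] fun s a => x a s := by
      filter_upwards [hx'.continuousAt.preimage_mem_nhds (h.open_target.mem_nhds htgt)] with s hs
      exact (heq _).symm.trans (h.right_inv hs)
    have h3 := (h2.hasDerivAt_iff.1 h1).unique hx'
    have hinj : ∀ z, fderiv ℝ (orbitMap e p S) (q t) z = 0 → z = 0 := fun z hz => by
      obtain ⟨L, hL⟩ := hinv _ hqs
      rw [← hL] at hz
      exact L.map_eq_zero_iff.1 hz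
    obtain ⟨A, hA⟩ := hlie (q t).1
    obtain ⟨ψ, hψ⟩ := he.exists_fderiv_param hX A hA
    have h4 : ∀ w a, fderiv ℝ (orbitMap e p S) (q t) (w, 0) a = field X (ψ w) (x a t) :=
      fun w a => by
        rw [he.fderiv_orbitMap (hsub hqs), ← horb a]
        exact hψ _ w (hsub hqs a)
    -- Since `h4` factors the derivative of `orbitMap` on vectors `(w, 0)` through `ψ`, injectivity
    -- of that derivative passes to `ψ`. Then `ψ` is onto, and `Y t` is `field X (ψ w)` for some
    -- `w`.
    have hψinj : Function.Injective (ψ : (Fin r → ℝ) →ₗ[ℝ] Fin r → ℝ) := by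
      refine (injective_iff_map_eq_zero _).2 fun w hw => ?_
      refine (Prod.ext_iff.1 (hinj (w, 0) (funext fun a => ?_))).1
      rw [h4, show ψ w = 0 from hw, map_zero]
      rfl
    obtain ⟨w, hw⟩ := (LinearMap.injective_iff_surjective.1 hψinj) b
    -- Both vectors are sent to the velocity of the `m`-tuple, so the transversal coordinate in `S`
    -- has zero derivative.
    have h5 : deriv q t = (w, 0) := by
      rw [← sub_eq_zero]
      refine hinj _ ?_
      rw [map_sub, sub_eq_zero, h3]
      ext1 a
      rw [h4, show ψ w = b from hw, hb]
    have h6 : HasDerivAt (fun s => (q s).1) w t := by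
      have := hasFDerivAt_fst.comp_hasDerivAt t hqd
      rw [h5] at this
      exact this
    have h7 := hasDerivAt_comp_pair (he.hasFDerivAt hdom) h6 (hasDerivAt_const t k)
    rw [hψ _ w hdom, show ψ w = b from hw, hb] at h7
    exact h7
  have hmaps : MapsTo (fun q : ℝ × (Fin m → E n) × E n => q.2) (constDom D) D := fun _ hq => hq
  refine ⟨Φ, D, ⟨hD.preimage continuous_snd, ⟨p, 0, hDp 0⟩, ?_, ?_, hsol,
    eq_of_solution (fun Y hY => hY.1) hsol⟩, ?_⟩
  · exact (he.contDiffOn.comp (hc.mono inter_subset_left) fun _ hq => hq.2).comp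
      contDiffOn_snd hmaps
  · rintro t x k ⟨-, hk⟩
    exact he.isInvertible_fderiv_space hX hk
  · refine ⟨mapsTo_univ _ _, fun k _ k' _ hkk => ?_, fun k _ => ⟨k, hDp k, hΦp k⟩⟩
    exact (hΦp k).symm.trans (Eq.trans hkk (hΦp k'))

/-- A finite-dimensional Lie algebra of vector fields admits superposition rules that are complete
at the points of a nonempty open set. -/
theorem IsLieAlgebra.exists_superposition_rule {V₀ : Submodule ℝ (E n → E n)}
    [FiniteDimensional ℝ V₀] (hV₀ : IsLieAlgebra V₀) :
    ∃ (m : ℕ) (U : Set (Fin m → E n)), IsOpen U ∧ U.Nonempty ∧ ∀ p ∈ U,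
      ∃ (Φ : (Fin m → E n) → E n → E n) (D : Set ((Fin m → E n) × E n)),
        IsLieSuperpositionRule V₀ Φ D ∧ IsCompleteAt (constRule Φ) (constDom D) p := by
  let b := Module.finBasis ℝ V₀
  let X : Fin (Module.finrank ℝ V₀) → E n → E n := fun i => b i
  have hX : ∀ i, ContDiff ℝ ∞ (X i) := fun i => hV₀.smooth _ (b i).2
  have hfield : ∀ v, field X v = (b.equivFun.symm v : V₀) := fun v => by
    rw [b.equivFun_symm_apply, field, Fintype.linearCombination_apply]
    simp [X]
  have hmem : ∀ v, field X v ∈ V₀ := fun v => by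
    rw [hfield]
    exact Subtype.coe_prop _
  have hsurj : ∀ v (hv : v ∈ V₀), field X (b.equivFun ⟨v, hv⟩) = v := fun v hv => by
    rw [hfield, LinearEquiv.symm_apply_apply]
  have hinj : Function.Injective (field X) := fun v w hvw => by
    rw [hfield, hfield] at hvw
    exact b.equivFun.symm.injective (Subtype.ext hvw)
  have hdiff : ∀ v, Differentiable ℝ (field X v) := fun v =>
    (contDiff_field_apply hX v).differentiable (by simp)
  have hlie : ∀ v, ∃ A : (Fin (Module.finrank ℝ V₀) → ℝ) →L[ℝ] Fin (Module.finrank ℝ V₀) → ℝ,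
      ∀ c, VectorField.lieBracket ℝ (field X v) (field X c) = field X (A c) := by
    intro v
    have hbr : ∀ c, VectorField.lieBracket ℝ (field X v) (field X c) ∈ V₀ := fun c =>
      hV₀.lie_mem _ (hmem v) _ (hmem c)
    refine ⟨LinearMap.toContinuousLinearMap
      { toFun := fun c => b.equivFun ⟨_, hbr c⟩
        map_add' := fun c d => hinj ?_
        map_smul' := fun a c => hinj ?_ }, fun c => (hsurj _ (hbr c)).symm⟩
    · rw [(field X).map_add (b.equivFun _), hsurj, hsurj, hsurj, map_add]
      exact funext fun x => VectorField.lieBracket_add_right (hdiff c x) (hdiff d x)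
    · rw [RingHom.id_apply, (field X).map_smul a (b.equivFun _), hsurj, hsurj, map_smul]
      exact funext fun x => VectorField.lieBracket_const_smul_right (hdiff c x)
  obtain ⟨m, p₀, hp₀⟩ := exists_separating_points (field X) hinj
  exact ⟨m, {p | ∀ v, prolongation X p v = 0 → v = 0}, isOpen_injective_prolongation hX,
    ⟨p₀, fun v hv => hp₀ v fun a => congrFun hv a⟩, fun p hp =>
      QuasiLie.exists_superposition_rule hX hlie hp fun v hv => ⟨_, hsurj v hv⟩⟩

end LieTheorem

end QuasiLie

/-! ### The proposition on `S_g(W,V;V₀)` -/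

theorem mainTheorem3 {n : ℕ} (W V V₀ : Submodule ℝ (QuasiLie.E n → QuasiLie.E n))
    (hS : QuasiLie.IsQuasiLieScheme W V)
    (g : QuasiLie.PartialFlow n) (hg : g ∈ QuasiLie.generalizedFlows W)
    (hV₀ : QuasiLie.IsLieAlgebra V₀) (hV₀V : V₀ ≤ V) :
    QuasiLie.IsLieFamily (QuasiLie.quasiLieFamily W V g V₀) ∧
    ∀ (m : ℕ) (Φ : (Fin m → QuasiLie.E n) → QuasiLie.E n → QuasiLie.E n)
      (D : Set ((Fin m → QuasiLie.E n) × QuasiLie.E n)),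
      QuasiLie.IsLieSuperpositionRule V₀ Φ D →
        QuasiLie.IsSuperpositionRule (QuasiLie.quasiLieFamily W V g V₀)
          (g.conjRule Φ) (g.conjDom Φ D) ∧
        (∀ p, QuasiLie.IsCompleteAt (QuasiLie.constRule Φ) (QuasiLie.constDom D) p →
          QuasiLie.IsCompleteAt (g.conjRule Φ) (g.conjDom Φ D) p) := by
  obtain ⟨w, hw, hgw⟩ := hg
  have := hS.finiteDimensional
  have : FiniteDimensional ℝ V₀ := Submodule.finiteDimensional_of_le hV₀V
  have key : ∀ (m : ℕ) (Φ : (Fin m → QuasiLie.E n) → QuasiLie.E n → QuasiLie.E n)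
      (D : Set ((Fin m → QuasiLie.E n) × QuasiLie.E n)),
      QuasiLie.IsLieSuperpositionRule V₀ Φ D →
        QuasiLie.IsSuperpositionRule (QuasiLie.quasiLieFamily W V g V₀)
          (g.conjRule Φ) (g.conjDom Φ D) := fun m Φ D h =>
    hgw.isSuperpositionRule_conjRule hV₀.smooth hw.1 h (fun _ hX => hX.1.1.1) fun _ hX => hX.2
  refine ⟨?_, fun m Φ D h => ⟨key m Φ D h, fun p hp => hgw.isCompleteAt_conjRule hp⟩⟩
  obtain ⟨m, U, hU, hne, hrule⟩ := hV₀.exists_superposition_rule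
  refine ⟨m, U, hU, hne, fun p hp => ?_⟩
  obtain ⟨Φ, D, h, hc⟩ := hrule p hp
  exact ⟨_, _, key m Φ D h, hgw.isCompleteAt_conjRule hc⟩
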